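/- Let $d,k\ge 1$ be integers and $R>0$. Let $\mathcal P_2$ be the set of Borel probability measures on $\mathbb R^d$ with finite second moment, endowed with the Wasserstein distance $W_2$; for $m,\nu\in\mathcal P_2$ let $\Gamma_0(m,\nu)$ be the set of optimal transport plans for the quadratic cost. **First order calculus.** For $U:\mathcal P_2\to\mathbb R$, a field $\zeta\in L^2(m;\mathbb R^d)$ is a subgradient of $U$ at $m$ if $$U[\nu]-U[m]\ \ge\ \inf_{\gamma\in\Gamma_0(m,\nu)}\int\langle\zeta(x),y-x\rangle\,\gamma(dx,dy)+o(W_2(m,\nu)),$$ and a supergradient of $U$ at $m$ if $-\zeta$ is a subgradient of $-U$ at $m$. $U$ is differentiable at $m$ if it has both a subgradient and a supergradient at $m$, and its Wasserstein gradient $\nabla_wU[m]$ is the subgradient of minimal $L^2(m)$-norm. For a vector field $\zeta$ put $\zeta\cdot(U[m]):=\int\langle\nabla_wU[m],\zeta\rangle\,dm$. **Second order calculus.** Let $T_m\mathcal P_2$ be the closure of $\nabla C_c^\infty(\mathbb R^d)$ in $L^2(m;\mathbb R^d)$. $U$ has a Hessian at $m$ if $U$ is differentiable in a neighborhood of $m$,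 if $\nu\mapsto\zeta\cdot(U[\nu])$ is differentiable at $m$ for every $\zeta\in C_c^\infty(\mathbb R^d;\mathbb R^d)$, and if the form $$(\zeta_1,\zeta_2)\mapsto \zeta_1\cdot\bigl(\zeta_2\cdot(U[m])\bigr)-(\nabla\zeta_2\,\zeta_1)\cdot(U[m])$$ on $\nabla C_c^\infty(\mathbb R^d)$ extends to a bounded bilinear form $\mathrm{Hess}\,U[m]$ on $T_m\mathcal P_2$. The partial Wasserstein Laplacian is $\triangle_wU[m]:=\sum_{i=1}^d\mathrm{Hess}\,U[m](\zeta_i,\zeta_i)$, where $\zeta_i$ is the Wasserstein gradient of the $i$-th moment $m\mapsto\int x_i\,m(dx)$. For $U,V$ differentiable on $\mathcal P_2$ set $$D_2(\nabla_wU,\nabla_wV)(m_1,m_2):=\int\!\!\int\langle\nabla_wU[m_1](q_1),\nabla_wV[m_2](q_2)\rangle\,m_1(dq_1)\,m_2(dq_2).$$ **The signed measure.** Let $B_R$ be the closed ball of radius $R$ centered at the origin of $\mathbb R^d$. For a nonempty $I\subseteq\{1,\dots,k\}$ and $x\in(\mathbb R^d)^k$ let $m_{x_I}:=\frac1{|I|}\sum_{i\in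 I}\delta_{x_i}$. For nonempty $I,J\subseteq\{1,\dots,k\}$ let $\mathbb P^{I,J,R}$ be the push forward of the Lebesgue measure on $B_R^k$ by $x\mapsto(m_{x_I},m_{x_J})\in\mathcal P_2\times\mathcal P_2$, and let $$\mathbb P^{k,R}:=\frac{k^2}{(k!)^3}\sum_{r=1}^k\sum_{p=1}^k(-1)^{r+p}r^kp^k\sum_{|I|=r}\ \sum_{|J|=p}\mathbb P^{I,J,R}.$$ **Theorem.** Let $\Phi,\Psi:(\mathbb R^d)^k\to\mathbb R$ be of class $C^3$, symmetric (invariant under permutations of the $k$ variables in $\mathbb R^d$) and supported in $B_R^k$, and for $\Theta\in\{\Phi,\Psi\}$ set $F_\Theta[m]:=\frac1k\int\Theta(x_1,\dots,x_k)\,m(dx_1)\cdots m(dx_k)$. Then, at every $m\in\mathcal P_2$, $F_\Phi$ and $F_\Psi$ are differentiable with a unique Wasserstein gradient, and $F_\Phi$ has a Hessian and a well-defined partial Wasserstein Laplacian; both integrands below are integrable with respect to $\mathbb P^{k,R}$, and $$-\int\triangle_wF_\Phi[m_1]\,F_\Psi[m_2]\,d\mathbb P^{k,R}(m_1,m_2)=\int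 D_2(\nabla_wF_\Phi,\nabla_wF_\Psi)(m_1,m_2)\,d\mathbb P^{k,R}(m_1,m_2).$$ -/

import Mathlib

open MeasureTheory
open scoped ENNReal ContDiff

noncomputable section

namespace Wasserstein

/-- `ℝ^d` with its Euclidean norm. -/
abbrev E (d : ℕ) : Type := EuclideanSpace ℝ (Fin d)

/-- `𝒫₂(ℝ^d)`: Borel probability measures on `ℝ^d` with finite second moment. -/
structure P2 (d : ℕ) : Type where
  toMeasure : Measure (E d)
  isProb : IsProbabilityMeasure toMeasure
  secondMoment : ∫⁻ x, ‖x‖ₑ ^ 2 ∂toMeasure < ⊤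

instance {d : ℕ} (m : P2 d) : IsProbabilityMeasure m.toMeasure := m.isProb

/-- `Γ(m, ν)`: the transport plans, i.e. measures on `ℝ^d × ℝ^d` with marginals `m` and `ν`. -/
def plans {d : ℕ} (m ν : P2 d) : Set (Measure (E d × E d)) :=
  {γ | γ.map Prod.fst = m.toMeasure ∧ γ.map Prod.snd = ν.toMeasure}

/-- Quadratic cost of a transport plan. -/
def planCost {d : ℕ} (γ : Measure (E d × E d)) : ℝ≥0∞ := ∫⁻ p, ‖p.1 - p.2‖ₑ ^ 2 ∂γ

/-- `W₂²(m, ν)`, as an extended nonnegative number (it is finite on `𝒫₂`). -/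
def optCost {d : ℕ} (m ν : P2 d) : ℝ≥0∞ := ⨅ γ ∈ plans m ν, planCost γ

/-- The Wasserstein distance `W₂`. -/
def W2 {d : ℕ} (m ν : P2 d) : ℝ := Real.sqrt (optCost m ν).toReal

/-- `Γ₀(m, ν)`: the optimal transport plans. -/
def optPlans {d : ℕ} (m ν : P2 d) : Set (Measure (E d × E d)) :=
  {γ | γ ∈ plans m ν ∧ planCost γ = optCost m ν}

/-- The topology of the metric `W₂`: a set is open iff it contains a `W₂`-ball around each of
its points. -/
instance {d : ℕ} : TopologicalSpace (P2 d) where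
  IsOpen s := ∀ m ∈ s, ∃ ε : ℝ, 0 < ε ∧ ∀ ν, W2 m ν < ε → ν ∈ s
  isOpen_univ := fun _ _ => ⟨1, one_pos, fun _ _ => trivial⟩
  isOpen_inter := by
    rintro s t hs ht m ⟨hms, hmt⟩
    obtain ⟨a, ha, hA⟩ := hs m hms
    obtain ⟨b, hb, hB⟩ := ht m hmt
    exact ⟨min a b, lt_min ha hb, fun ν hν =>
      ⟨hA ν (hν.trans_le (min_le_left _ _)), hB ν (hν.trans_le (min_le_right _ _))⟩⟩
  isOpen_sUnion := by
    rintro S hS m ⟨s, hs, hms⟩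
    obtain ⟨a, ha, hA⟩ := hS s hs m hms
    exact ⟨a, ha, fun ν hν => ⟨s, hs, hA ν hν⟩⟩

/-- The Borel `σ`-algebra of `(𝒫₂, W₂)`. The product `𝒫₂ × 𝒫₂` carries the product `σ`-algebra,
which is its Borel `σ`-algebra since `(𝒫₂, W₂)` is separable. -/
instance {d : ℕ} : MeasurableSpace (P2 d) := borel (P2 d)

instance {d : ℕ} : BorelSpace (P2 d) := ⟨rfl⟩

/-! ### First order calculus -/

/-- The subdifferential of `U` at `m`: those `ζ ∈ L²(m)` such that
`U[ν] - U[m] ≥ inf_{γ ∈ Γ₀(m, ν)} ∫ ζ(x) · (y - x) γ(dx, dy) + o(W₂(m, ν))`. -/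
def subdiff {d : ℕ} (U : P2 d → ℝ) (m : P2 d) : Set (Lp (E d) 2 m.toMeasure) :=
  {ζ | ∀ ε : ℝ, 0 < ε → ∃ δ : ℝ, 0 < δ ∧ ∀ ν : P2 d, W2 m ν < δ →
    (⨅ γ ∈ optPlans m ν, ((∫ p, inner ℝ (ζ p.1) (p.2 - p.1) ∂γ : ℝ) : EReal)) ≤
      ((U ν - U m + ε * W2 m ν : ℝ) : EReal)}

/-- The superdifferential of `U` at `m`. -/
def superdiff {d : ℕ} (U : P2 d → ℝ) (m : P2 d) : Set (Lp (E d) 2 m.toMeasure) :=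
  {ζ | -ζ ∈ subdiff (fun ν => -U ν) m}

/-- `U` is differentiable at `m`: it has a subgradient and a supergradient there. -/
def DiffAt {d : ℕ} (U : P2 d → ℝ) (m : P2 d) : Prop :=
  (subdiff U m).Nonempty ∧ (superdiff U m).Nonempty

/-- `ζ` is an element of minimal norm of the subdifferential of `U` at `m`. -/
def IsGradAt {d : ℕ} (U : P2 d → ℝ) (m : P2 d) (ζ : Lp (E d) 2 m.toMeasure) : Prop :=
  ζ ∈ subdiff U m ∧ ∀ η ∈ subdiff U m, ‖ζ‖ ≤ ‖η‖

open Classical in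
/-- The Wasserstein gradient `∇_w U[m] ∈ L²(m)` (and `0` if there is none). -/
def wGrad {d : ℕ} (U : P2 d → ℝ) (m : P2 d) : Lp (E d) 2 m.toMeasure :=
  if h : ∃ ζ, IsGradAt U m ζ then h.choose else 0

/-- The derivative of `U` at `m` along a vector field:
`ζ · (U[m]) = ⟨∇_w U[m]; ζ⟩_m = ∫ ⟨∇_w U[m](x), ζ(x)⟩ m(dx)`. -/
def dirDeriv {d : ℕ} (ζ : E d → E d) (U : P2 d → ℝ) (m : P2 d) : ℝ :=
  ∫ x, inner ℝ (wGrad U m x) (ζ x) ∂m.toMeasure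

/-! ### Second order calculus -/

/-- `T_m 𝒫₂`: the closure in `L²(m)` of the gradients of functions in `C_c^∞(ℝ^d)`. -/
def tangent {d : ℕ} (m : P2 d) : Submodule ℝ (Lp (E d) 2 m.toMeasure) :=
  (Submodule.span ℝ {ζ : Lp (E d) 2 m.toMeasure | ∃ φ : E d → ℝ,
    ContDiff ℝ ∞ φ ∧ HasCompactSupport φ ∧
      (ζ : E d → E d) =ᵐ[m.toMeasure] gradient φ}).topologicalClosure

/-- `H` is the Hessian of `U` at `m`: `U` is differentiable near `m`, `ν ↦ ζ · (U[ν])` is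
differentiable at `m` for all `ζ ∈ C_c^∞(ℝ^d, ℝ^d)`, and `H` is the bounded bilinear form on
`T_m 𝒫₂` that extends
`(ζ₁, ζ₂) ↦ ζ₁ · (ζ₂ · (U[m])) - (∇ζ₂ ζ₁) · (U[m])`, for `ζ₁, ζ₂ ∈ ∇ C_c^∞(ℝ^d)`. -/
def IsHessAt {d : ℕ} (U : P2 d → ℝ) (m : P2 d)
    (H : tangent m →L[ℝ] tangent m →L[ℝ] ℝ) : Prop :=
  (∃ δ : ℝ, 0 < δ ∧ ∀ ν : P2 d, W2 m ν < δ → DiffAt U ν) ∧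
  (∀ ζ : E d → E d, ContDiff ℝ ∞ ζ → HasCompactSupport ζ →
    DiffAt (fun ν => dirDeriv ζ U ν) m) ∧
  ∀ φ₁ φ₂ : E d → ℝ, ContDiff ℝ ∞ φ₁ → HasCompactSupport φ₁ →
    ContDiff ℝ ∞ φ₂ → HasCompactSupport φ₂ → ∀ z₁ z₂ : tangent m,
    ((z₁ : Lp (E d) 2 m.toMeasure) : E d → E d) =ᵐ[m.toMeasure] gradient φ₁ →
    ((z₂ : Lp (E d) 2 m.toMeasure) : E d → E d) =ᵐ[m.toMeasure] gradient φ₂ →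
    H z₁ z₂ = dirDeriv (gradient φ₁) (fun ν => dirDeriv (gradient φ₂) U ν) m -
      dirDeriv (fun x => fderiv ℝ (gradient φ₂) x (gradient φ₁ x)) U m

/-- The `i`-th moment `m ↦ ∫ x_i m(dx)`. -/
def moment {d : ℕ} (i : Fin d) (m : P2 d) : ℝ := ∫ x, x i ∂m.toMeasure

/-- `U` has a Hessian at `m` and `L = ∑ᵢ Hess U[m](ζᵢ, ζᵢ)`, where `ζᵢ ∈ T_m 𝒫₂` is the
Wasserstein gradient at `m` of the `i`-th moment. -/
def HasLaplacianAt {d : ℕ} (U : P2 d → ℝ) (m : P2 d) (L : ℝ) : Prop :=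
  ∃ H : tangent m →L[ℝ] tangent m →L[ℝ] ℝ, IsHessAt U m H ∧
    ∃ ζ : Fin d → tangent m,
      (∀ i, IsGradAt (moment i) m (ζ i : Lp (E d) 2 m.toMeasure)) ∧
      L = ∑ i, H (ζ i) (ζ i)

open Classical in
/-- The (partial) Wasserstein Laplacian `(△_w U)[m]` (and `0` if it does not exist). -/
def wLaplacian {d : ℕ} (U : P2 d → ℝ) (m : P2 d) : ℝ :=
  if h : ∃ L, HasLaplacianAt U m L then h.choose else 0

/-- `D₂(∇_w U, ∇_w V)(m₁, m₂) = ∫ ⟨∇_w U[m₁](q₁); ∇_w V[m₂](q₂)⟩ m₁(dq₁) m₂(dq₂)`. -/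
def D2 {d : ℕ} (U V : P2 d → ℝ) (z : P2 d × P2 d) : ℝ :=
  ∫ q, inner ℝ (wGrad U z.1 q.1) (wGrad V z.2 q.2) ∂(z.1.toMeasure.prod z.2.toMeasure)

/-- The `k`-polynomial `F_Φ[m] = (1/k) ∫ Φ(x₁, …, x_k) m(dx₁) ⋯ m(dx_k)`. -/
def polyF {d k : ℕ} (Φ : (Fin k → E d) → ℝ) (m : P2 d) : ℝ :=
  (1 / (k : ℝ)) * ∫ x, Φ x ∂(Measure.pi fun _ : Fin k => m.toMeasure)

/-! ### The signed measure on `𝒫₂ × 𝒫₂` -/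

lemma isProb_avg {α : Type*} [MeasurableSpace α] {k : ℕ} (I : Finset (Fin k)) (hI : I.Nonempty)
    (x : Fin k → α) :
    IsProbabilityMeasure ((I.card : ℝ≥0∞)⁻¹ • ∑ i ∈ I, Measure.dirac (x i)) := by
  constructor
  have h0 : (I.card : ℝ≥0∞) ≠ 0 := by simpa using hI.ne_empty
  simp [ENNReal.inv_mul_cancel h0 (ENNReal.natCast_ne_top _)]

lemma lintegral_avg {α : Type*} [MeasurableSpace α] {k : ℕ} (I : Finset (Fin k))
    (x : Fin k → α) {f : α → ℝ≥0∞} (hf : Measurable f) :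
    ∫⁻ y, f y ∂((I.card : ℝ≥0∞)⁻¹ • ∑ i ∈ I, Measure.dirac (x i)) =
      (I.card : ℝ≥0∞)⁻¹ * ∑ i ∈ I, f (x i) := by
  rw [lintegral_smul_measure, lintegral_finsetSum_measure, smul_eq_mul]
  congr 1
  exact Finset.sum_congr rfl fun i _ => lintegral_dirac' _ hf

open Classical in
/-- The empirical measure `m_{x_I} = (1/|I|) ∑_{i ∈ I} δ_{x_i}` of a nonempty `I ⊆ {1, …, k}`
(and `δ_0`, which is never used, for the empty set). -/
def empirical {d k : ℕ} (I : Finset (Fin k)) (x : Fin k → E d) : P2 d :=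
  if hI : I.Nonempty then
    { toMeasure := (I.card : ℝ≥0∞)⁻¹ • ∑ i ∈ I, Measure.dirac (x i)
      isProb := isProb_avg I hI x
      secondMoment := by
        rw [lintegral_avg I x (by fun_prop)]
        refine ENNReal.mul_lt_top ?_ ?_
        · simpa using hI.card_pos
        · exact ENNReal.sum_lt_top.2 fun i _ => ENNReal.pow_lt_top enorm_lt_top }
  else
    { toMeasure := Measure.dirac 0
      isProb := inferInstance
      secondMoment := by rw [lintegral_dirac' _ (by fun_prop)]; simp }

lemma W2_empirical_le {d k : ℕ} {I : Finset (Fin k)} (hI : I.Nonempty) (x y : Fin k → E d) :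
    W2 (empirical I x) (empirical I y) ≤
      Real.sqrt ((I.card : ℝ)⁻¹ * ∑ i ∈ I, ‖x i - y i‖ ^ 2) := by
  refine Real.sqrt_le_sqrt ?_
  have hc : optCost (empirical I x) (empirical I y) ≤
      (I.card : ℝ≥0∞)⁻¹ * ∑ i ∈ I, ‖x i - y i‖ₑ ^ 2 := by
    have := lintegral_avg I (fun i => (x i, y i))
      (f := fun p : E d × E d => ‖p.1 - p.2‖ₑ ^ 2) (by fun_prop)
    rw [← this]
    refine iInf₂_le_of_le _ ?_ le_rfl
    constructor
    · simp [empirical, hI, Measure.map_smul,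
        Measure.map_finset_sum (measurable_fst.aemeasurable), Measure.map_dirac' measurable_fst]
    · simp [empirical, hI, Measure.map_smul,
        Measure.map_finset_sum (measurable_snd.aemeasurable), Measure.map_dirac' measurable_snd]
  have hfin : (I.card : ℝ≥0∞)⁻¹ * ∑ i ∈ I, ‖x i - y i‖ₑ ^ 2 ≠ ⊤ := by
    refine ENNReal.mul_ne_top ?_ ?_
    · simpa using hI.ne_empty
    · exact (ENNReal.sum_lt_top.2 fun i _ => ENNReal.pow_lt_top enorm_lt_top).ne
  refine (ENNReal.toReal_mono hfin hc).trans_eq ?_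
  rw [ENNReal.toReal_mul, ENNReal.toReal_sum fun i _ => (ENNReal.pow_lt_top enorm_lt_top).ne]
  simp

lemma continuous_empirical {d k : ℕ} (I : Finset (Fin k)) :
    Continuous (empirical I : (Fin k → E d) → P2 d) := by
  by_cases hI : I.Nonempty
  · refine continuous_def.2 fun s hs => isOpen_iff_mem_nhds.2 fun x hx => ?_
    obtain ⟨ε, hε, h⟩ := hs _ hx
    have hcont : Continuous fun y : Fin k → E d =>
        Real.sqrt ((I.card : ℝ)⁻¹ * ∑ i ∈ I, ‖x i - y i‖ ^ 2) := by fun_prop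
    have : ∀ᶠ y in nhds x, Real.sqrt ((I.card : ℝ)⁻¹ * ∑ i ∈ I, ‖x i - y i‖ ^ 2) < ε := by
      refine hcont.continuousAt.eventually_lt continuousAt_const ?_
      simpa using hε
    filter_upwards [this] with y hy
    exact h _ ((W2_empirical_le hI x y).trans_lt hy)
  · have : (empirical I : (Fin k → E d) → P2 d) = fun _ => empirical I 0 := by
      funext x
      simp [empirical, hI]
    rw [this]
    exact continuous_const

/-- `B_R^k ⊆ (ℝ^d)^k`, where `B_R` is the closed ball of radius `R` centered at the origin. -/
def ballPow (d k : ℕ) (R : ℝ) : Set (Fin k → E d) :=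
  {x | ∀ i, x i ∈ Metric.closedBall (0 : E d) R}

lemma isCompact_ballPow (d k : ℕ) (R : ℝ) : IsCompact (ballPow d k R) := by
  have : ballPow d k R = Set.pi Set.univ fun _ => Metric.closedBall (0 : E d) R := by
    ext x; simp [ballPow]
  rw [this]
  exact isCompact_univ_pi fun _ => isCompact_closedBall _ _

/-- `ℙ^{I,J,R}`: the push forward of the Lebesgue measure on `B_R^k` by
`x ↦ (m_{x_I}, m_{x_J})`. -/
def PIJ (d : ℕ) {k : ℕ} (I J : Finset (Fin k)) (R : ℝ) : Measure (P2 d × P2 d) :=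
  ((volume : Measure (Fin k → E d)).restrict (ballPow d k R)).map
    fun x => (empirical I x, empirical J x)

lemma measurable_empirical_pair {d k : ℕ} (I J : Finset (Fin k)) :
    Measurable fun x : Fin k → E d => (empirical I x, empirical J x) :=
  (continuous_empirical I).measurable.prodMk (continuous_empirical J).measurable

instance {d k : ℕ} (I J : Finset (Fin k)) (R : ℝ) : IsFiniteMeasure (PIJ d I J R) := by
  have : IsFiniteMeasure ((volume : Measure (Fin k → E d)).restrict (ballPow d k R)) :=
    ⟨by simpa using (isCompact_ballPow d k R).measure_lt_top⟩
  unfold PIJ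
  infer_instance

/-- The signed measure
`ℙ^{k,R} = (k² / (k!)³) ∑_{r=1}^k ∑_{p=1}^k (-1)^{r+p} r^k p^k ∑_{|I|=r} ∑_{|J|=p} ℙ^{I,J,R}`,
where `I`, `J` run over the subsets of `{1, …, k}` with `r`, respectively `p`, elements. -/
def PkR (d k : ℕ) (R : ℝ) : SignedMeasure (P2 d × P2 d) :=
  ((k : ℝ) ^ 2 / (k.factorial : ℝ) ^ 3) •
    ∑ r ∈ Finset.Icc 1 k, ∑ p ∈ Finset.Icc 1 k,
      ((-1 : ℝ) ^ (r + p) * (r : ℝ) ^ k * (p : ℝ) ^ k) •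
        ∑ I ∈ Finset.powersetCard r (Finset.univ : Finset (Fin k)),
          ∑ J ∈ Finset.powersetCard p (Finset.univ : Finset (Fin k)),
            (PIJ d I J R).toSignedMeasure

end Wasserstein

end

open Wasserstein

/-! Everything reduces to ordinary integration by parts on `(ℝ^d)^k` in the diagonal directions `w_i
= (e_i, …, e_i)`. The factor `1/k` is absorbed into the integrand, so that one studies `polyInt Θ`,
the integral of `Θ` against `m^k`.

First order. Taking `k` independent copies of a transport plan and expanding `Θ` to second order
gives an expansion of `polyInt Θ` along every plan, with velocity `∇(polyPotential Θ m)` and a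
remainder bounded by the cost (`hasQuadExpansionAt_polyInt`). Such an expansion makes the velocity
`g` both a subgradient and a supergradient. Moreover every subgradient `η` satisfies `η - g ⟂ T_m`:
it is tested on the displacements `id + t∇φ`, whose optimal plans are close to the displacement
itself (`integral_sub_smul_sq_le`, `inner_sub_eq_zero_of_mem_subdiff`). Since `g` is tangent, it is
the unique subgradient of least norm (`HasQuadExpansionAt.isGradAt_iff`).

Second order. The derivative of `polyInt Θ` along `ζ` is `polyInt` of `x ↦ DΘ(x)(ζ(x_1), …,
ζ(x_k))`, so the class is stable under differentiation. In the Hessian form the terms with `∇ζ₂`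
cancel, leaving the integral of `D²Θ` on the lifted fields, which is bounded on `L²`. The moments
have the constant fields `e_i` as gradients; hence the Laplacian is the sum of the `polyInt` of
`∂²_{w_i}Θ`, and `D₂` is a sum of products of the `polyInt` of `∂_{w_i}Θ` and `∂_{w_i}Ξ`.

The signed measure. Polarization over empirical measures (`sum_polyInt_empirical`) recovers a
symmetric `Θ(x)`, up to the factor `(-1)^k k!`, from the values of `polyInt Θ` at the `m_{x_I}`. The
weights of `ℙ^{k,R}` are a product of two such sums, so integrating `polyInt Θ[m₁] · polyInt Ξ[m₂]`
yields `k²/k!` times `∫ Θ Ξ` over `B_R^k` (`integral_polyInt_mul_polyInt_PkR`). Derivatives along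
`w_i` stay symmetric, and the claim becomes `-∫ ∂²_{w_i}Θ · Ξ = ∫ ∂_{w_i}Θ · ∂_{w_i}Ξ`, without
boundary term because of the supports. -/

noncomputable section

open Filter Topology
open scoped NNReal Convolution

namespace Wasserstein

/-! ### Transport plans -/

/-- The integral of a continuous function with values in `[0, ∞)` is lower semicontinuous with
respect to weak convergence of probability measures. -/
lemma lowerSemicontinuous_lintegral_nnreal {X : Type*} [TopologicalSpace X] [MeasurableSpace X]
    [OpensMeasurableSpace X] {f : X → ℝ≥0} (hf : Continuous f) :
    LowerSemicontinuous fun μ : ProbabilityMeasure X => ∫⁻ x, f x ∂(μ : Measure X) := by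
  -- Truncations `min f n`: their integrals are weakly continuous in `μ`, and by monotone
  -- convergence their supremum is the integral of `f`.
  let F : ℕ → BoundedContinuousFunction X ℝ≥0 := fun n =>
    BoundedContinuousFunction.mkOfBound ⟨fun x => min (f x) (n : ℝ≥0),
      hf.min continuous_const⟩ n (fun x y => by
        have hx : ((min (f x) (n : ℝ≥0) : ℝ≥0) : ℝ) ≤ n := by exact_mod_cast min_le_right _ _
        have hy : ((min (f y) (n : ℝ≥0) : ℝ≥0) : ℝ) ≤ n := by exact_mod_cast min_le_right _ _
        have hx' := (min (f x) (n : ℝ≥0)).coe_nonneg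
        have hy' := (min (f y) (n : ℝ≥0)).coe_nonneg
        rw [NNReal.dist_eq, abs_le]
        constructor <;> simp only [ContinuousMap.coe_mk] <;> linarith)
  have hF : ∀ n x, F n x = min (f x) (n : ℝ≥0) := fun n x => rfl
  have h : ∀ μ : ProbabilityMeasure X, ∫⁻ x, f x ∂(μ : Measure X) =
      ⨆ n, ((μ.toFiniteMeasure.testAgainstNN (F n) : ℝ≥0) : ℝ≥0∞) := by
    intro μ
    have h1 : ∀ n, ((μ.toFiniteMeasure.testAgainstNN (F n) : ℝ≥0) : ℝ≥0∞) =
        ∫⁻ x, F n x ∂(μ : Measure X) := fun n => FiniteMeasure.testAgainstNN_coe_eq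
    simp_rw [h1]
    rw [← lintegral_iSup]
    · refine lintegral_congr fun x => ?_
      refine le_antisymm ?_ (iSup_le fun n => by
        rw [hF]; exact_mod_cast min_le_left _ _)
      obtain ⟨n, hn⟩ := exists_nat_ge (f x)
      refine le_iSup_of_le n ?_
      rw [hF, min_eq_left hn]
    · intro n
      exact (ENNReal.continuous_coe.comp (F n).continuous).measurable
    · intro a b hab x
      simp only [hF]
      norm_cast
      exact min_le_min le_rfl (by exact_mod_cast hab)
  simp_rw [h]
  refine lowerSemicontinuous_iSup fun n => Continuous.lowerSemicontinuous ?_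
  exact ENNReal.continuous_coe.comp (ProbabilityMeasure.continuous_testAgainstNN_eval (F n))

variable {d : ℕ}

lemma isProbabilityMeasure_of_mem_plans {m ν : P2 d} {γ : Measure (E d × E d)}
    (hγ : γ ∈ plans m ν) : IsProbabilityMeasure γ := by
  constructor
  have h := congrArg (fun μ => μ Set.univ) hγ.1
  simpa [Measure.map_apply measurable_fst] using h

lemma measurePreserving_fst_of_mem_plans {m ν : P2 d} {γ : Measure (E d × E d)}
    (hγ : γ ∈ plans m ν) : MeasurePreserving Prod.fst γ m.toMeasure :=
  ⟨measurable_fst, hγ.1⟩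

lemma measurePreserving_snd_of_mem_plans {m ν : P2 d} {γ : Measure (E d × E d)}
    (hγ : γ ∈ plans m ν) : MeasurePreserving Prod.snd γ ν.toMeasure :=
  ⟨measurable_snd, hγ.2⟩

lemma prod_mem_plans (m ν : P2 d) : m.toMeasure.prod ν.toMeasure ∈ plans m ν :=
  ⟨by rw [Measure.map_fst_prod]; simp, by rw [Measure.map_snd_prod]; simp⟩

/-- Direct method: plans with tight marginals form a tight family, hence a compact set by Prokhorov,
and the cost is lower semicontinuous. Existence matters because the infimum in `subdiff` over an
empty set would be `⊤`. -/
theorem optPlans_nonempty (m ν : P2 d) : (optPlans m ν).Nonempty := by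
  let f1 : ProbabilityMeasure (E d × E d) → ProbabilityMeasure (E d) :=
    fun γ => γ.map (continuous_fst.measurable.aemeasurable)
  let f2 : ProbabilityMeasure (E d × E d) → ProbabilityMeasure (E d) :=
    fun γ => γ.map (continuous_snd.measurable.aemeasurable)
  let S : Set (ProbabilityMeasure (E d × E d)) :=
    f1 ⁻¹' {⟨m.toMeasure, m.isProb⟩} ∩ f2 ⁻¹' {⟨ν.toMeasure, ν.isProb⟩}
  have hS : ∀ γ : ProbabilityMeasure (E d × E d), γ ∈ S ↔ (γ : Measure _) ∈ plans m ν := by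
    intro γ
    exact and_congr (Set.mem_singleton_iff.trans Subtype.ext_iff)
      (Set.mem_singleton_iff.trans Subtype.ext_iff)
  have hclosed : IsClosed S :=
    (isClosed_singleton.preimage (ProbabilityMeasure.continuous_map continuous_fst)).inter
      (isClosed_singleton.preimage (ProbabilityMeasure.continuous_map continuous_snd))
  have htight : IsTightMeasureSet
      {((μ : ProbabilityMeasure (E d × E d)) : Measure (E d × E d)) | μ ∈ S} := by
    refine IsTightMeasureSet.prodMk ?_ ?_
    · refine (isTightMeasureSet_singleton (μ := m.toMeasure)).subset ?_
      rintro _ ⟨_, ⟨γ, hγ, rfl⟩, rfl⟩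
      exact ((hS γ).1 hγ).1
    · refine (isTightMeasureSet_singleton (μ := ν.toMeasure)).subset ?_
      rintro _ ⟨_, ⟨γ, hγ, rfl⟩, rfl⟩
      exact ((hS γ).1 hγ).2
  have hcomp : IsCompact S := by
    simpa [hclosed.closure_eq] using isCompact_closure_of_isTightMeasureSet htight
  have hne : S.Nonempty := ⟨⟨m.toMeasure.prod ν.toMeasure, inferInstance⟩,
    (hS _).2 (prod_mem_plans m ν)⟩
  have hlsc : LowerSemicontinuous fun γ : ProbabilityMeasure (E d × E d) =>
      planCost (γ : Measure (E d × E d)) := by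
    have := lowerSemicontinuous_lintegral_nnreal (X := E d × E d)
      (f := fun p => ‖p.1 - p.2‖₊ ^ 2) (by fun_prop)
    simpa [planCost, enorm_eq_nnnorm] using this
  obtain ⟨γ, hγ, hmin⟩ := (hlsc.lowerSemicontinuousOn S).exists_isMinOn hne hcomp
  refine ⟨γ, (hS γ).1 hγ, le_antisymm ?_ (iInf₂_le _ ((hS γ).1 hγ))⟩
  refine le_iInf₂ fun γ' hγ' => ?_
  have := isProbabilityMeasure_of_mem_plans hγ'
  exact hmin (a := ⟨γ', this⟩) ((hS _).2 hγ')

lemma memLp_id (m : P2 d) : MemLp (fun x : E d => x) 2 m.toMeasure := by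
  refine ⟨by fun_prop, ?_⟩
  rw [eLpNorm_lt_top_iff_lintegral_rpow_enorm_lt_top (by simp) (by simp)]
  simpa using m.secondMoment

lemma memLp_sub_of_mem_plans {m ν : P2 d} {γ : Measure (E d × E d)} (hγ : γ ∈ plans m ν) :
    MemLp (fun p : E d × E d => p.2 - p.1) 2 γ :=
  ((memLp_id ν).comp_measurePreserving (measurePreserving_snd_of_mem_plans hγ)).sub
    ((memLp_id m).comp_measurePreserving (measurePreserving_fst_of_mem_plans hγ))

lemma planCost_toReal (γ : Measure (E d × E d)) :
    (planCost γ).toReal = ∫ p, ‖p.2 - p.1‖ ^ 2 ∂γ := by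
  rw [integral_eq_lintegral_of_nonneg_ae (Eventually.of_forall fun p => by positivity)
    (by fun_prop)]
  congr 1
  refine lintegral_congr fun p => ?_
  rw [← enorm_norm, norm_sub_rev, ← ofReal_norm, norm_norm, ENNReal.ofReal_pow (norm_nonneg _)]

lemma planCost_ne_top {m ν : P2 d} {γ : Measure (E d × E d)} (hγ : γ ∈ plans m ν) :
    planCost γ ≠ ⊤ := by
  have h := (memLp_sub_of_mem_plans hγ).2
  rw [eLpNorm_lt_top_iff_lintegral_rpow_enorm_lt_top (by simp) (by simp)] at h
  refine ne_of_lt (lt_of_eq_of_lt (lintegral_congr fun p => ?_) h)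
  rw [← enorm_neg]; simp

lemma W2_sq_of_mem_optPlans {m ν : P2 d} {γ : Measure (E d × E d)} (hγ : γ ∈ optPlans m ν) :
    W2 m ν ^ 2 = ∫ p, ‖p.2 - p.1‖ ^ 2 ∂γ := by
  rw [W2, Real.sq_sqrt ENNReal.toReal_nonneg, ← hγ.2, planCost_toReal γ]

lemma W2_sq_le_of_mem_plans {m ν : P2 d} {γ : Measure (E d × E d)} (hγ : γ ∈ plans m ν) :
    W2 m ν ^ 2 ≤ ∫ p, ‖p.2 - p.1‖ ^ 2 ∂γ := by
  rw [W2, Real.sq_sqrt ENNReal.toReal_nonneg, ← planCost_toReal γ]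
  exact ENNReal.toReal_mono (planCost_ne_top hγ) (iInf₂_le _ hγ)

lemma W2_nonneg (m ν : P2 d) : 0 ≤ W2 m ν := Real.sqrt_nonneg _

end Wasserstein

namespace Wasserstein

/-! ### Gradients of functionals with a quadratic expansion -/

lemma _root_.MeasureTheory.MeasurePreserving.integral_comp_of_aestronglyMeasurable
    {X Y G : Type*} [MeasurableSpace X] [MeasurableSpace Y] [NormedAddCommGroup G]
    [NormedSpace ℝ G] {μ : Measure X} {ν : Measure Y} {T : X → Y} (h : MeasurePreserving T μ ν)
    {f : Y → G} (hf : AEStronglyMeasurable f ν) : ∫ x, f (T x) ∂μ = ∫ y, f y ∂ν := by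
  obtain ⟨hT, rfl⟩ := h
  exact (integral_map hT.aemeasurable hf).symm

lemma _root_.MeasureTheory.MemLp.integrable_inner_two {X F : Type*} [MeasurableSpace X]
    [NormedAddCommGroup F] [InnerProductSpace ℝ F] {μ : Measure X} {f g : X → F}
    (hf : MemLp f 2 μ) (hg : MemLp g 2 μ) : Integrable (fun x => inner ℝ (f x) (g x)) μ := by
  refine (L2.integrable_inner (𝕜 := ℝ) (hf.toLp f) (hg.toLp g)).congr ?_
  filter_upwards [hf.coeFn_toLp, hg.coeFn_toLp] with x h1 h2
  rw [h1, h2]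

/-- First order Taylor expansion with a uniform quadratic remainder. -/
lemma _root_.ContDiff.exists_quadratic_remainder {V : Type*} [NormedAddCommGroup V]
    [NormedSpace ℝ V] {f : V → ℝ} (hf : ContDiff ℝ 2 f) (hc : HasCompactSupport f) :
    ∃ C : ℝ, 0 ≤ C ∧ ∀ x y, |f y - f x - fderiv ℝ f x (y - x)| ≤ C * ‖y - x‖ ^ 2 := by
  obtain ⟨K, hK⟩ := ContDiff.lipschitzWith_of_hasCompactSupport (𝕂 := ℝ) (n := 1)
    (hc.fderiv ℝ) (hf.fderiv_right (by norm_num)) (by norm_num)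
  refine ⟨K, K.2, fun x y => ?_⟩
  -- On the segment the derivative differs from `fderiv ℝ f x` by at most `K * ‖y - x‖`, with `K`
  -- its Lipschitz constant; the mean value inequality supplies the other factor.
  have h := (convex_segment x y).norm_image_sub_le_of_norm_hasFDerivWithin_le' (𝕜 := ℝ)
    (f := f) (f' := fun z => fderiv ℝ f z) (φ := fderiv ℝ f x) (C := K * ‖y - x‖)
    (fun z _ => ((hf.differentiable (by norm_num)) z).hasFDerivAt.hasFDerivWithinAt)
    (fun z hz => by
      refine (hK.norm_sub_le z x).trans ?_
      gcongr
      obtain ⟨a, b, ha, hb, hab, rfl⟩ := hz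
      have : a • x + b • y - x = b • (y - x) := by
        rw [← eq_sub_iff_add_eq] at hab; subst hab; module
      rw [this, norm_smul, Real.norm_of_nonneg hb]
      exact mul_le_of_le_one_left (norm_nonneg _) (by linarith))
    (left_mem_segment ℝ x y) (right_mem_segment ℝ x y)
  rw [← Real.norm_eq_abs]
  refine h.trans_eq (by ring)

variable {d : ℕ}

lemma memLp_comp_fst_of_mem_plans {m ν : P2 d} {γ : Measure (E d × E d)} (hγ : γ ∈ plans m ν)
    {f : E d → E d} (hf : MemLp f 2 m.toMeasure) :
    MemLp (fun p : E d × E d => f p.1) 2 γ :=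
  hf.comp_measurePreserving (measurePreserving_fst_of_mem_plans hγ)

/-- The deterministic plan moving each point `x` by a vector `v x`. -/
lemma exists_map_mem_plans (m : P2 d) {v : E d → E d} (hv : MemLp v 2 m.toMeasure)
    (hvm : Measurable v) : ∃ ν : P2 d, ν.toMeasure = m.toMeasure.map (fun x => x + v x) ∧
      m.toMeasure.map (fun x => (x, x + v x)) ∈ plans m ν := by
  have hm : Measurable fun x => x + v x := by fun_prop
  have hL : MemLp (fun x => x + v x) 2 m.toMeasure := (memLp_id m).add hv
  refine ⟨⟨m.toMeasure.map (fun x => x + v x),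
    Measure.isProbabilityMeasure_map hm.aemeasurable, ?_⟩, rfl, ?_, ?_⟩
  · rw [lintegral_map (by fun_prop) hm]
    have h := hL.2
    rw [eLpNorm_lt_top_iff_lintegral_rpow_enorm_lt_top (by simp) (by simp)] at h
    simpa using h
  · rw [Measure.map_map measurable_fst (by fun_prop)]
    exact Measure.map_id
  · rw [Measure.map_map measurable_snd (by fun_prop)]
    rfl

/-- Every optimal plan for a small displacement along `v = ∇φ` is close to the displacement. -/
lemma integral_sub_smul_sq_le {m ν : P2 d} {v : E d → E d} {φ : E d → ℝ} {C t : ℝ}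
    (hv : MemLp v 2 m.toMeasure) (hvm : Measurable v) (hφ : Continuous φ)
    (hb : ∃ M, ∀ x, ‖φ x‖ ≤ M) (ht : 0 ≤ t) (hC : 0 ≤ C)
    (hφv : ∀ x y, |φ y - φ x - inner ℝ (v x) (y - x)| ≤ C * ‖y - x‖ ^ 2)
    (hν : ν.toMeasure = m.toMeasure.map (fun x => x + t • v x))
    {γ : Measure (E d × E d)} (hγ : γ ∈ plans m ν)
    (hcost : ∫ p, ‖p.2 - p.1‖ ^ 2 ∂γ ≤ t ^ 2 * ∫ x, ‖v x‖ ^ 2 ∂m.toMeasure) :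
    ∫ p, ‖p.2 - p.1 - t • v p.1‖ ^ 2 ∂γ ≤ 4 * C * t ^ 3 * ∫ x, ‖v x‖ ^ 2 ∂m.toMeasure := by
  have := isProbabilityMeasure_of_mem_plans hγ
  obtain ⟨M, hM⟩ := hb
  have hsub := memLp_sub_of_mem_plans hγ
  have hv1 := memLp_comp_fst_of_mem_plans hγ hv
  have hi1 : Integrable (fun p : E d × E d => ‖p.2 - p.1‖ ^ 2) γ := hsub.integrable_norm_pow (by simp)
  have hi2 : Integrable (fun p : E d × E d => inner ℝ (v p.1) (p.2 - p.1)) γ :=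
    hv1.integrable_inner_two hsub
  have hi3 : Integrable (fun p : E d × E d => ‖v p.1‖ ^ 2) γ := hv1.integrable_norm_pow (by simp)
  have hiφ1 : Integrable (fun p : E d × E d => φ p.1) γ :=
    Integrable.of_bound (by fun_prop) M (Eventually.of_forall fun p => hM _)
  have hiφ2 : Integrable (fun p : E d × E d => φ p.2) γ :=
    Integrable.of_bound (by fun_prop) M (Eventually.of_forall fun p => hM _)
  have hvi : Integrable (fun x => ‖v x‖ ^ 2) m.toMeasure := hv.integrable_norm_pow (by simp)
  have hN : ∫ p, ‖v p.1‖ ^ 2 ∂γ = ∫ x, ‖v x‖ ^ 2 ∂m.toMeasure := by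
    rw [← hγ.1, integral_map (by fun_prop) (by fun_prop)]
  have hi4 : Integrable (fun p : E d × E d =>
      ‖p.2 - p.1‖ ^ 2 - 2 * t * inner ℝ (v p.1) (p.2 - p.1)) γ := hi1.sub (hi2.const_mul _)
  -- After expanding the square only the cross term is unknown; it has to be bounded below by about
  -- `t` times the energy of `v`.
  have hexp : ∫ p, ‖p.2 - p.1 - t • v p.1‖ ^ 2 ∂γ = ∫ p, ‖p.2 - p.1‖ ^ 2 ∂γ -
      2 * t * ∫ p, inner ℝ (v p.1) (p.2 - p.1) ∂γ + t ^ 2 * ∫ x, ‖v x‖ ^ 2 ∂m.toMeasure := by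
    rw [← hN, ← integral_const_mul, ← integral_const_mul, ← integral_sub hi1 (hi2.const_mul _),
      ← integral_add hi4 (hi3.const_mul _)]
    refine integral_congr_ae (Eventually.of_forall fun p => ?_)
    simp only
    rw [norm_sub_sq_real, inner_smul_right, norm_smul, mul_pow, Real.norm_eq_abs, sq_abs,
      real_inner_comm]
    ring
  have hlow : ∫ p, (φ p.2 - φ p.1) ∂γ ≤ ∫ p, inner ℝ (v p.1) (p.2 - p.1) ∂γ +
      C * ∫ p, ‖p.2 - p.1‖ ^ 2 ∂γ := by
    rw [← integral_const_mul, ← integral_add hi2 (hi1.const_mul _)]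
    refine integral_mono (hiφ2.sub hiφ1) (hi2.add (hi1.const_mul _)) fun p => ?_
    have := (abs_le.1 (hφv p.1 p.2)).2
    simp only
    linarith
  -- This quantity depends only on the marginals, so it takes the same value along `γ` and along the
  -- displacement. It is what transfers the cross term from one plan to the other.
  have hφint : ∫ p, (φ p.2 - φ p.1) ∂γ = ∫ x, (φ (x + t • v x) - φ x) ∂m.toMeasure := by
    rw [integral_sub hiφ2 hiφ1, integral_sub]
    · congr 1
      · have h1 : ∫ p, φ p.2 ∂γ = ∫ y, φ y ∂ν.toMeasure := by
          rw [← hγ.2, integral_map (by fun_prop) (by fun_prop)]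
        rw [h1, hν, integral_map (by fun_prop) (by fun_prop)]
      · rw [← hγ.1, integral_map (by fun_prop) (by fun_prop)]
    · exact Integrable.of_bound (by fun_prop) M (Eventually.of_forall fun p => hM _)
    · exact Integrable.of_bound (by fun_prop) M (Eventually.of_forall fun p => hM _)
  have hup : (t - C * t ^ 2) * ∫ x, ‖v x‖ ^ 2 ∂m.toMeasure ≤
      ∫ x, (φ (x + t • v x) - φ x) ∂m.toMeasure := by
    rw [← integral_const_mul]
    refine integral_mono (hvi.const_mul _) (Integrable.of_bound (by fun_prop) (M + M)
      (Eventually.of_forall fun p => (norm_sub_le _ _).trans (add_le_add (hM _) (hM _))))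
      fun x => ?_
    have := (abs_le.1 (hφv x (x + t • v x))).1
    rw [add_sub_cancel_left, inner_smul_right, real_inner_self_eq_norm_sq, norm_smul, mul_pow,
      Real.norm_eq_abs, sq_abs] at this
    simp only
    nlinarith
  rw [hexp]
  set N := ∫ x, ‖v x‖ ^ 2 ∂m.toMeasure
  set I := ∫ p, inner ℝ (v p.1) (p.2 - p.1) ∂γ
  set J := ∫ p, ‖p.2 - p.1‖ ^ 2 ∂γ
  have h1 : t * N - 2 * C * t ^ 2 * N ≤ I := by
    have : C * J ≤ C * (t ^ 2 * N) := by gcongr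
    linarith [hlow, hup, hφint]
  have h2 : t * (t * N - 2 * C * t ^ 2 * N) ≤ t * I := by gcongr
  nlinarith

/-- `U` has a first order expansion at `m` along all plans, with velocity `g` and a remainder
controlled by the cost of the plan. -/
def HasQuadExpansionAt (U : P2 d → ℝ) (m : P2 d) (g : Lp (E d) 2 m.toMeasure) : Prop :=
  ∃ C : ℝ, 0 ≤ C ∧ ∀ ν : P2 d, ∀ γ ∈ plans m ν,
    |U ν - U m - ∫ p, inner ℝ (g p.1) (p.2 - p.1) ∂γ| ≤ C * ∫ p, ‖p.2 - p.1‖ ^ 2 ∂γ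

/-- A single optimal plan bounds the infimum from above, and along it the remainder is `C * W2 ^ 2`,
which is `o(W2)`. -/
lemma HasQuadExpansionAt.mem_subdiff {U : P2 d → ℝ} {m : P2 d} {g : Lp (E d) 2 m.toMeasure}
    (h : HasQuadExpansionAt U m g) : g ∈ subdiff U m := by
  obtain ⟨C, hC, h⟩ := h
  intro ε hε
  -- `C + 1` instead of `C`, since `C` may vanish.
  refine ⟨ε / (C + 1), by positivity, fun ν hν => ?_⟩
  obtain ⟨γ, hγ⟩ := optPlans_nonempty m ν
  refine iInf₂_le_of_le γ hγ (EReal.coe_le_coe_iff.2 ?_)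
  have h1 := (abs_le.1 (h ν γ hγ.1)).1
  rw [← W2_sq_of_mem_optPlans hγ] at h1
  have h2 : C * W2 m ν ^ 2 ≤ ε * W2 m ν := by
    have h3 : C * W2 m ν ≤ ε := by
      rw [lt_div_iff₀ (by positivity)] at hν
      nlinarith [W2_nonneg m ν]
    nlinarith [W2_nonneg m ν]
  linarith

lemma HasQuadExpansionAt.neg {U : P2 d → ℝ} {m : P2 d} {g : Lp (E d) 2 m.toMeasure}
    (h : HasQuadExpansionAt U m g) : HasQuadExpansionAt (fun ν => -U ν) m (-g) := by
  obtain ⟨C, hC, h⟩ := h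
  refine ⟨C, hC, fun ν γ hγ => ?_⟩
  have : ∫ p, inner ℝ ((-g : Lp (E d) 2 m.toMeasure) p.1) (p.2 - p.1) ∂γ =
      - ∫ p, inner ℝ (g p.1) (p.2 - p.1) ∂γ := by
    rw [← integral_neg]
    refine integral_congr_ae ?_
    have h1 := (measurePreserving_fst_of_mem_plans hγ).quasiMeasurePreserving.ae_eq_comp
      (Lp.coeFn_neg g)
    filter_upwards [h1] with p hp
    simp only [Function.comp] at hp
    rw [hp]
    simp
  rw [this]
  refine le_of_eq_of_le ?_ (h ν γ hγ)
  rw [← abs_neg]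
  congr 1
  ring

lemma HasQuadExpansionAt.diffAt {U : P2 d → ℝ} {m : P2 d} {g : Lp (E d) 2 m.toMeasure}
    (h : HasQuadExpansionAt U m g) : DiffAt U m :=
  ⟨⟨g, h.mem_subdiff⟩, ⟨g, h.neg.mem_subdiff⟩⟩

lemma inner_gradient_eq_fderiv (φ : E d → ℝ) (x v : E d) :
    inner ℝ (gradient φ x) v = fderiv ℝ φ x v := by
  rw [gradient, InnerProductSpace.toDual_symm_apply]

lemma continuous_gradient {φ : E d → ℝ} (hφ : ContDiff ℝ 1 φ) : Continuous (gradient φ) :=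
  (InnerProductSpace.toDual ℝ (E d)).symm.continuous.comp (hφ.continuous_fderiv (by norm_num))

lemma hasCompactSupport_gradient {φ : E d → ℝ} (hφ : HasCompactSupport φ) :
    HasCompactSupport (gradient φ) :=
  (hφ.fderiv ℝ).comp_left (g := (InnerProductSpace.toDual ℝ (E d)).symm) (map_zero _)

lemma memLp_gradient {φ : E d → ℝ} (hφ : ContDiff ℝ 1 φ) (hc : HasCompactSupport φ)
    (μ : Measure (E d)) [IsFiniteMeasure μ] : MemLp (gradient φ) 2 μ := by
  obtain ⟨M, hM⟩ := (hasCompactSupport_gradient hc).exists_bound_of_continuous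
    (continuous_gradient hφ)
  exact MemLp.of_bound (continuous_gradient hφ).aestronglyMeasurable M (Eventually.of_forall hM)

/-- A subgradient of a functional with a quadratic expansion pairs with gradients of test functions
at most as much as the velocity of the expansion. -/
lemma integral_inner_gradient_le_of_mem_subdiff {U : P2 d → ℝ} {m : P2 d}
    {g η : Lp (E d) 2 m.toMeasure} (h : HasQuadExpansionAt U m g) (hη : η ∈ subdiff U m)
    {φ : E d → ℝ} (hφ : ContDiff ℝ ∞ φ) (hφc : HasCompactSupport φ) :
    ∫ x, inner ℝ (η x) (gradient φ x) ∂m.toMeasure ≤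
      ∫ x, inner ℝ (g x) (gradient φ x) ∂m.toMeasure := by
  obtain ⟨C', hC', h⟩ := h
  have hφ2 : ContDiff ℝ 2 φ := contDiff_infty.1 hφ 2
  have hφ1 : ContDiff ℝ 1 φ := contDiff_infty.1 hφ 1
  obtain ⟨C, hC, hT⟩ := hφ2.exists_quadratic_remainder hφc
  have hb := hφc.exists_bound_of_continuous hφ.continuous
  have hv := memLp_gradient hφ1 hφc m.toMeasure
  have hvm := (continuous_gradient hφ1).measurable
  simp only [← inner_gradient_eq_fderiv] at hT
  set v := gradient φ with hvdef
  set N := ∫ x, ‖v x‖ ^ 2 ∂m.toMeasure with hN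
  have hN0 : 0 ≤ N := integral_nonneg fun x => by positivity
  set S := ∫ x, ‖η x‖ ^ 2 ∂m.toMeasure with hS
  set A := ∫ x, inner ℝ (η x) (v x) ∂m.toMeasure with hA
  set B := ∫ x, inner ℝ (g x) (v x) ∂m.toMeasure with hB
  -- The subgradient inequality is applied to `ν = (id + t∇φ)_# m`, divided by `t`, and `t → 0` for
  -- fixed `ε`; then `ε → 0`.
  have key : ∀ ε > 0, A - B ≤ ε * (S / 2 + √N) := by
    intro ε hε
    obtain ⟨δ, hδ, hη⟩ := hη ε hε
    have hlim : Tendsto (fun t : ℝ => ε * (S / 2 + √N) + t * (2 * C * N / ε + C' * N)) (𝓝[>] 0)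
        (𝓝 (ε * (S / 2 + √N) + 0 * (2 * C * N / ε + C' * N))) :=
      (Continuous.tendsto (by fun_prop) 0).mono_left nhdsWithin_le_nhds
    rw [zero_mul, add_zero] at hlim
    refine ge_of_tendsto hlim ?_
    have hδ' : 0 < δ / (√N + 1) := by positivity
    filter_upwards [Ioo_mem_nhdsGT hδ'] with t ht
    obtain ⟨ht0, htδ⟩ := ht
    obtain ⟨ν, hν, hplan⟩ := exists_map_mem_plans m (v := fun x => t • v x) (hv.const_smul t)
      (hvm.const_smul t)
    have hcost : ∫ p, ‖p.2 - p.1‖ ^ 2 ∂(m.toMeasure.map fun x => (x, x + t • v x)) =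
        t ^ 2 * N := by
      rw [integral_map (by fun_prop) (by fun_prop), hN, ← integral_const_mul]
      refine integral_congr_ae (Eventually.of_forall fun x => ?_)
      simp only [add_sub_cancel_left, norm_smul, mul_pow, Real.norm_eq_abs, sq_abs]
    have hW2 : W2 m ν ^ 2 ≤ t ^ 2 * N := (W2_sq_le_of_mem_plans hplan).trans_eq hcost
    have hW : W2 m ν ≤ t * √N := by
      refine le_of_sq_le_sq ?_ (by positivity)
      rwa [mul_pow, Real.sq_sqrt hN0]
    have hWδ : W2 m ν < δ := by
      rw [lt_div_iff₀ (by positivity)] at htδ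
      nlinarith [Real.sqrt_nonneg N]
    have hup : U ν - U m ≤ t * B + C' * (t ^ 2 * N) := by
      -- The displacement plan is not known to be optimal, which is why the expansion is required
      -- along all plans.
      have h1 := (abs_le.1 (h ν _ hplan)).2
      rw [hcost, integral_map (by fun_prop) (((Lp.stronglyMeasurable g).comp_measurable
        measurable_fst).aestronglyMeasurable.inner (by fun_prop))] at h1
      simp only [add_sub_cancel_left, inner_smul_right, integral_const_mul] at h1
      linarith
    -- The bound holds for every optimal plan, hence for the infimum. The error `⟨η, y - x - t v⟩`
    -- is split by Young's inequality with weight `ε t`: the first part is `ε t S / 2`, and the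
    -- second is `O(t²)` for fixed `ε` because the squared defect is `O(t³)`.
    have hlow : ((t * A - (ε * t * S / 2 + 2 * C * N * t ^ 2 / ε) : ℝ) : EReal) ≤
        ⨅ γ ∈ optPlans m ν, ((∫ p, inner ℝ (η p.1) (p.2 - p.1) ∂γ : ℝ) : EReal) := by
      refine le_iInf₂ fun γ hγ => EReal.coe_le_coe_iff.2 ?_
      have hsub := memLp_sub_of_mem_plans hγ.1
      have hv1 := memLp_comp_fst_of_mem_plans hγ.1 hv
      have hη1 := memLp_comp_fst_of_mem_plans hγ.1 (Lp.memLp η)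
      have hr : MemLp (fun p : E d × E d => p.2 - p.1 - t • v p.1) 2 γ :=
        hsub.sub (hv1.const_smul t)
      have hres := integral_sub_smul_sq_le hv hvm hφ.continuous hb ht0.le hC hT hν hγ.1
        (by rw [← W2_sq_of_mem_optPlans hγ]; exact hW2)
      have hAγ : ∫ p, inner ℝ (η p.1) (v p.1) ∂γ = A :=
        (measurePreserving_fst_of_mem_plans hγ.1).integral_comp_of_aestronglyMeasurable
          (f := fun x => inner ℝ (η x) (v x)) ((Lp.aestronglyMeasurable η).inner hvm.aestronglyMeasurable)
      have hSγ : ∫ p, ‖η p.1‖ ^ 2 ∂γ = S :=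
        (measurePreserving_fst_of_mem_plans hγ.1).integral_comp_of_aestronglyMeasurable
          ((Lp.aestronglyMeasurable η).norm.pow 2)
      have hi1 := hη1.integrable_inner_two hsub
      have hi2 : Integrable (fun p : E d × E d => t * inner ℝ (η p.1) (v p.1)) γ :=
        (hη1.integrable_inner_two hv1).const_mul t
      have hi3 : Integrable (fun p : E d × E d => (ε * t / 2) * ‖η p.1‖ ^ 2) γ :=
        (hη1.integrable_norm_pow (by simp)).const_mul _
      have hi4 : Integrable (fun p : E d × E d =>
          (1 / (2 * (ε * t))) * ‖p.2 - p.1 - t • v p.1‖ ^ 2) γ :=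
        (hr.integrable_norm_pow (by simp)).const_mul _
      have hi5 : Integrable (fun p : E d × E d => (ε * t / 2) * ‖η p.1‖ ^ 2 +
          (1 / (2 * (ε * t))) * ‖p.2 - p.1 - t • v p.1‖ ^ 2) γ := hi3.add hi4
      have hmono : ∫ p, t * inner ℝ (η p.1) (v p.1) ∂γ ≤ ∫ p, (inner ℝ (η p.1) (p.2 - p.1) +
          ((ε * t / 2) * ‖η p.1‖ ^ 2 +
            (1 / (2 * (ε * t))) * ‖p.2 - p.1 - t • v p.1‖ ^ 2)) ∂γ := by
        refine integral_mono hi2 (hi1.add hi5) fun p => ?_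
        have hs : 0 < ε * t := by positivity
        have h1 : -(‖η p.1‖ * ‖p.2 - p.1 - t • v p.1‖) ≤
            inner ℝ (η p.1) (p.2 - p.1 - t • v p.1) :=
          (abs_le.1 (abs_real_inner_le_norm _ _)).1
        have h2 : ‖η p.1‖ * ‖p.2 - p.1 - t • v p.1‖ ≤ (ε * t / 2) * ‖η p.1‖ ^ 2 +
            (1 / (2 * (ε * t))) * ‖p.2 - p.1 - t • v p.1‖ ^ 2 := by
          generalize ‖η p.1‖ = a
          generalize ‖p.2 - p.1 - t • v p.1‖ = b
          generalize ε * t = s at hs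
          have : s / 2 * a ^ 2 + 1 / (2 * s) * b ^ 2 - a * b = (s * a - b) ^ 2 / (2 * s) := by
            field_simp; ring
          have : 0 ≤ (s * a - b) ^ 2 / (2 * s) := by positivity
          linarith
        rw [inner_sub_right, inner_smul_right] at h1
        simp only
        linarith
      rw [integral_add hi1 hi5, integral_add hi3 hi4, integral_const_mul,
        integral_const_mul, integral_const_mul, hAγ, hSγ] at hmono
      have h3 : 1 / (2 * (ε * t)) * ∫ p, ‖p.2 - p.1 - t • v p.1‖ ^ 2 ∂γ ≤
          2 * C * N * t ^ 2 / ε := by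
        calc _ ≤ 1 / (2 * (ε * t)) * (4 * C * t ^ 3 * N) := by gcongr
          _ = _ := by field_simp; ring
      linarith
    have hfin := EReal.coe_le_coe_iff.1 (hlow.trans (hη ν hWδ))
    have h5 : ε * W2 m ν ≤ ε * (t * √N) := by gcongr
    have h6 : t * (A - B) ≤ t * (ε * (S / 2 + √N) + t * (2 * C * N / ε + C' * N)) := by
      have : t * (ε * (S / 2 + √N) + t * (2 * C * N / ε + C' * N)) =
        ε * t * S / 2 + ε * (t * √N) + 2 * C * N * t ^ 2 / ε + C' * (t ^ 2 * N) := by ring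
      linarith
    exact le_of_mul_le_mul_left h6 ht0
  have hlim : Tendsto (fun ε : ℝ => ε * (S / 2 + √N)) (𝓝[>] 0) (𝓝 (0 * (S / 2 + √N))) :=
    (Continuous.tendsto (by fun_prop) 0).mono_left nhdsWithin_le_nhds
  rw [zero_mul] at hlim
  have := ge_of_tendsto hlim (by filter_upwards [self_mem_nhdsWithin] with ε hε using key ε hε)
  linarith

lemma gradient_neg_fun (φ : E d → ℝ) : gradient (fun x => -φ x) = fun x => -gradient φ x := by
  funext x
  simp only [gradient, fderiv_fun_neg, map_neg]

/-- The inequality for test gradients, applied to `φ` and to `-φ`, becomes an equality, which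
extends to the closed span by linearity and continuity. -/
lemma inner_sub_eq_zero_of_mem_subdiff {U : P2 d → ℝ} {m : P2 d}
    {g η w : Lp (E d) 2 m.toMeasure} (h : HasQuadExpansionAt U m g) (hη : η ∈ subdiff U m)
    (hw : w ∈ tangent m) : inner ℝ (η - g) w = 0 := by
  have hspan : ∀ z ∈ {ζ : Lp (E d) 2 m.toMeasure | ∃ φ : E d → ℝ,
      ContDiff ℝ ∞ φ ∧ HasCompactSupport φ ∧ (ζ : E d → E d) =ᵐ[m.toMeasure] gradient φ},
      inner ℝ (η - g) z = 0 := by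
    rintro z ⟨φ, hφ, hφc, hz⟩
    have hL2 : ∀ f : Lp (E d) 2 m.toMeasure,
        inner ℝ f z = ∫ x, inner ℝ (f x) (gradient φ x) ∂m.toMeasure := by
      intro f
      rw [L2.inner_def]
      refine integral_congr_ae ?_
      filter_upwards [hz] with x hx
      rw [hx]
    have h1 := integral_inner_gradient_le_of_mem_subdiff h hη hφ hφc
    have h2 := integral_inner_gradient_le_of_mem_subdiff h hη (φ := fun x => -φ x) hφ.neg
      (hφc.comp_left (g := fun y : ℝ => -y) neg_zero)
    simp only [gradient_neg_fun, inner_neg_right, integral_neg] at h2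
    rw [inner_sub_left, hL2, hL2]
    linarith
  have hzero : Set.EqOn (innerSL ℝ (η - g)) (0 : Lp (E d) 2 m.toMeasure →L[ℝ] ℝ)
      (closure (Submodule.span ℝ {ζ : Lp (E d) 2 m.toMeasure | ∃ φ : E d → ℝ,
      ContDiff ℝ ∞ φ ∧ HasCompactSupport φ ∧
        (ζ : E d → E d) =ᵐ[m.toMeasure] gradient φ} : Set (Lp (E d) 2 m.toMeasure))) :=
    ContinuousLinearMap.eqOn_closure_span fun z hz => hspan z hz
  exact hzero hw

/-- If the velocity of a quadratic expansion is a tangent field, it is the Wasserstein gradient. -/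
theorem HasQuadExpansionAt.isGradAt_iff {U : P2 d → ℝ} {m : P2 d}
    {g : Lp (E d) 2 m.toMeasure} (h : HasQuadExpansionAt U m g) (hg : g ∈ tangent m)
    (ζ : Lp (E d) 2 m.toMeasure) : IsGradAt U m ζ ↔ ζ = g := by
  -- Pythagoras: `g` is itself tangent, hence orthogonal to `η - g`.
  have hpyth : ∀ η ∈ subdiff U m, ‖η‖ ^ 2 = ‖g‖ ^ 2 + ‖η - g‖ ^ 2 := by
    intro η hη
    have h1 := inner_sub_eq_zero_of_mem_subdiff h hη hg
    have h2 := norm_add_sq_real (η - g) g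
    rw [h1, sub_add_cancel] at h2
    linarith
  constructor
  · rintro ⟨hζ, hmin⟩
    have h1 := hpyth ζ hζ
    have h2 := hmin g h.mem_subdiff
    have h3 : ‖ζ‖ ^ 2 ≤ ‖g‖ ^ 2 := by gcongr
    have h4 : ‖ζ - g‖ = 0 := by
      have : ‖ζ - g‖ ^ 2 = 0 := le_antisymm (by linarith) (by positivity)
      simpa using this
    exact sub_eq_zero.1 (norm_eq_zero.1 h4)
  · rintro rfl
    refine ⟨h.mem_subdiff, fun η hη => ?_⟩
    refine le_of_sq_le_sq ?_ (norm_nonneg _)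
    rw [hpyth η hη]
    linarith [sq_nonneg ‖η - ζ‖]

lemma HasQuadExpansionAt.existsUnique_isGradAt {U : P2 d → ℝ} {m : P2 d}
    {g : Lp (E d) 2 m.toMeasure} (h : HasQuadExpansionAt U m g) (hg : g ∈ tangent m) :
    ∃! ζ, IsGradAt U m ζ :=
  ⟨g, (h.isGradAt_iff hg g).2 rfl, fun ζ hζ => (h.isGradAt_iff hg ζ).1 hζ⟩

lemma HasQuadExpansionAt.wGrad_eq {U : P2 d → ℝ} {m : P2 d}
    {g : Lp (E d) 2 m.toMeasure} (h : HasQuadExpansionAt U m g) (hg : g ∈ tangent m) :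
    wGrad U m = g := by
  have hex := (h.existsUnique_isGradAt hg).exists
  rw [wGrad, dif_pos hex]
  exact (h.isGradAt_iff hg _).1 hex.choose_spec

end Wasserstein

namespace Wasserstein

/-! ### Tangent fields -/

variable {d : ℕ}

lemma norm_gradient_sub_gradient (φ ψ : E d → ℝ) (x : E d) :
    ‖gradient φ x - gradient ψ x‖ = ‖fderiv ℝ φ x - fderiv ℝ ψ x‖ := by
  rw [gradient, gradient, ← map_sub, LinearIsometryEquiv.norm_map]

/-- A compactly supported `C¹` function is approximated, uniformly with its derivative, by test
functions. -/
lemma exists_contDiff_norm_fderiv_sub_le {φ : E d → ℝ} (hφ : ContDiff ℝ 1 φ)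
    (hc : HasCompactSupport φ) {ε : ℝ} (hε : 0 < ε) :
    ∃ ψ : E d → ℝ, ContDiff ℝ ∞ ψ ∧ HasCompactSupport ψ ∧
      ∀ x, ‖fderiv ℝ ψ x - fderiv ℝ φ x‖ ≤ ε := by
  have hcont : Continuous (fderiv ℝ φ) := hφ.continuous_fderiv (by norm_num)
  have hunif : UniformContinuous (fderiv ℝ φ) :=
    hcont.uniformContinuous_of_tendsto_cocompact (x := 0)
      (hc.fderiv ℝ).is_zero_at_infty
  obtain ⟨δ, hδ, h⟩ := Metric.uniformContinuous_iff.1 hunif ε hε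
  -- Mollification at the scale `δ` of uniform continuity of the derivative; the derivative of the
  -- convolution is the convolution of the derivative.
  let ρ : ContDiffBump (0 : E d) := ⟨δ / 2, δ, by positivity, by linarith⟩
  have hρL : LocallyIntegrable (ρ.normed volume) := ρ.continuous_normed.locallyIntegrable
  refine ⟨ρ.normed volume ⋆[ContinuousLinearMap.lsmul ℝ ℝ, volume] φ, ?_, ?_, fun x => ?_⟩
  · exact ρ.hasCompactSupport_normed.contDiff_convolution_left _ (n := ⊤) ρ.contDiff_normed
      hφ.continuous.locallyIntegrable
  · exact ρ.hasCompactSupport_normed.convolution _ hc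
  · rw [(hc.hasFDerivAt_convolution_right _ hρL hφ x).fderiv, ← dist_eq_norm]
    have := ρ.dist_normed_convolution_le (μ := volume) (g := fderiv ℝ φ) (x₀ := x) (ε := ε)
      hcont.aestronglyMeasurable fun y hy => (h hy).le
    exact this

/-- Uniform approximation of the gradients is `L²(m)` approximation, `m` being a probability. The
`C¹` case is needed because the potentials of polynomial functionals are only shown to be `C¹`. -/
lemma toLp_gradient_mem_tangent (m : P2 d) {φ : E d → ℝ} (hφ : ContDiff ℝ 1 φ)
    (hc : HasCompactSupport φ) : (memLp_gradient hφ hc m.toMeasure).toLp _ ∈ tangent m := by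
  rw [tangent, ← SetLike.mem_coe, Submodule.topologicalClosure_coe, Metric.mem_closure_iff]
  intro ε hε
  obtain ⟨ψ, hψ, hψc, h⟩ := exists_contDiff_norm_fderiv_sub_le hφ hc (half_pos hε)
  have hψ1 : ContDiff ℝ 1 ψ := contDiff_infty.1 hψ 1
  refine ⟨(memLp_gradient hψ1 hψc m.toMeasure).toLp _, Submodule.subset_span
    ⟨ψ, hψ, hψc, MemLp.coeFn_toLp _⟩, ?_⟩
  rw [dist_eq_norm, ← MemLp.toLp_sub]
  refine (Lp.norm_le_of_ae_bound (half_pos hε).le ?_).trans_lt (?_ : _ < ε)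
  · filter_upwards [MemLp.coeFn_toLp ((memLp_gradient hφ hc m.toMeasure).sub
      (memLp_gradient hψ1 hψc m.toMeasure))] with x hx
    rw [hx, Pi.sub_apply, norm_gradient_sub_gradient, norm_sub_rev]
    exact h x
  · have : measureUnivNNReal m.toMeasure = 1 := by simp [measureUnivNNReal]
    simp only [this, NNReal.coe_one, Real.one_rpow, one_mul]
    linarith

/-! ### Polynomial functionals -/

/-- The functional `m ↦ ∫ Θ(x₁, …, x_k) m(dx₁) ⋯ m(dx_k)`. -/
def polyInt {k : ℕ} (Θ : (Fin k → E d) → ℝ) (m : P2 d) : ℝ :=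
  ∫ x, Θ x ∂(Measure.pi fun _ : Fin k => m.toMeasure)

lemma polyF_eq_polyInt {k : ℕ} (Φ : (Fin k → E d) → ℝ) :
    polyF Φ = polyInt fun x => (1 / (k : ℝ)) * Φ x := by
  funext m
  rw [polyF, polyInt, integral_const_mul]

/-- Replacing one coordinate of independent random variables by an independent copy does not change
their joint law. -/
lemma measurePreserving_update {X : Type*} [MeasurableSpace X] (γ : Measure X)
    [IsProbabilityMeasure γ] {k : ℕ} (j : Fin k) :
    MeasurePreserving (fun z : (Fin k → X) × X => Function.update z.1 j z.2)
      ((Measure.pi fun _ => γ).prod γ) (Measure.pi fun _ => γ) := by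
  have hm : Measurable fun z : (Fin k → X) × X => Function.update z.1 j z.2 := by
    refine measurable_pi_iff.2 fun i => ?_
    by_cases h : i = j
    · subst h; simpa using measurable_snd
    · simp only [Function.update_of_ne h]; fun_prop
  refine ⟨hm, (Measure.pi_eq fun s hs => ?_).symm⟩
  rw [Measure.map_apply hm (MeasurableSet.univ_pi hs)]
  have hpre : (fun z : (Fin k → X) × X => Function.update z.1 j z.2) ⁻¹' Set.univ.pi s =
      Set.univ.pi (Function.update s j Set.univ) ×ˢ s j := by
    ext z
    simp only [Set.mem_preimage, Set.mem_univ_pi, Set.mem_prod]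
    constructor
    · intro h
      refine ⟨fun i => ?_, by simpa using h j⟩
      by_cases hi : i = j
      · subst hi; simp
      · simpa [hi] using h i
    · rintro ⟨h1, h2⟩ i
      by_cases hi : i = j
      · subst hi; simpa using h2
      · simpa [hi] using h1 i
  rw [hpre, Measure.prod_prod, Measure.pi_pi, ← Finset.prod_erase_mul _ _ (Finset.mem_univ j),
    ← Finset.prod_erase_mul (a := j) _ (fun i => γ (s i)) (Finset.mem_univ j)]
  simp only [Function.update_self, measure_univ, mul_one]
  congr 1
  refine Finset.prod_congr rfl fun i hi => ?_
  rw [Function.update_of_ne (Finset.ne_of_mem_erase hi)]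

/-- The potential of the Wasserstein gradient of `polyInt Θ` at `m`. -/
def polyPotential {k : ℕ} (Θ : (Fin k → E d) → ℝ) (m : P2 d) (q : E d) : ℝ :=
  ∫ x, ∑ j, Θ (Function.update x j q) ∂(Measure.pi fun _ : Fin k => m.toMeasure)

variable {k : ℕ} {Θ : (Fin k → E d) → ℝ}

lemma hasCompactSupport_polyPotential (hc : HasCompactSupport Θ) (m : P2 d) :
    HasCompactSupport (polyPotential Θ m) := by
  obtain ⟨r, hr⟩ := hc.isCompact.isBounded.exists_norm_le
  refine HasCompactSupport.intro (isCompact_closedBall 0 r) fun q hq => ?_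
  rw [polyPotential]
  have : ∀ x : Fin k → E d, ∑ j, Θ (Function.update x j q) = 0 := by
    intro x
    refine Finset.sum_eq_zero fun j _ => ?_
    by_contra hne
    refine hq ?_
    have h1 := hr _ (subset_tsupport _ (Function.mem_support.2 hne))
    rw [mem_closedBall_zero_iff]
    simpa using (norm_le_pi_norm _ j).trans h1
  simp [this]

/-- The derivative in `q` of `∑ⱼ Θ(x₁, …, q, …, x_k)`, with `q` at the `j`-th place. -/
def updateDeriv (Θ : (Fin k → E d) → ℝ) (q : E d) (x : Fin k → E d) : E d →L[ℝ] ℝ :=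
  ∑ j, (fderiv ℝ Θ (Function.update x j q)).comp
    (ContinuousLinearMap.single ℝ (fun _ : Fin k => E d) j)

lemma hasFDerivAt_sum_update (hΘ : ContDiff ℝ 1 Θ) (x : Fin k → E d) (q : E d) :
    HasFDerivAt (fun q => ∑ j, Θ (Function.update x j q)) (updateDeriv Θ q x) q := by
  refine HasFDerivAt.fun_sum fun j _ => ?_
  have h1 : HasFDerivAt Θ _ (Function.update x j q) :=
    (hΘ.differentiable (by norm_num) _).hasFDerivAt
  refine h1.comp q ((hasFDerivAt_update x q).congr_fderiv ?_)
  ext1 v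
  funext i
  by_cases h : i = j
  · subst h; simp
  · simp [h]

lemma continuous_updateDeriv (hΘ : ContDiff ℝ 1 Θ) :
    Continuous fun z : E d × (Fin k → E d) => updateDeriv Θ z.1 z.2 := by
  have := hΘ.continuous_fderiv (by norm_num)
  unfold updateDeriv
  fun_prop

lemma exists_norm_fderiv_le (hΘ : ContDiff ℝ 1 Θ) (hc : HasCompactSupport Θ) :
    ∃ M : ℝ, 0 ≤ M ∧ ∀ x, ‖fderiv ℝ Θ x‖ ≤ M := by
  obtain ⟨M, hM⟩ := (hc.fderiv ℝ).exists_bound_of_continuous (hΘ.continuous_fderiv (by norm_num))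
  exact ⟨M, (norm_nonneg _).trans (hM 0), hM⟩

lemma norm_updateDeriv_le {M : ℝ} (hM : ∀ x, ‖fderiv ℝ Θ x‖ ≤ M) (q : E d) (x : Fin k → E d) :
    ‖updateDeriv Θ q x‖ ≤ k * M := by
  refine (norm_sum_le _ _).trans ?_
  have : ∀ j : Fin k, ‖(fderiv ℝ Θ (Function.update x j q)).comp
      (ContinuousLinearMap.single ℝ (fun _ : Fin k => E d) j)‖ ≤ M := by
    intro j
    refine (ContinuousLinearMap.opNorm_comp_le _ _).trans ?_
    have h1 : ‖ContinuousLinearMap.single ℝ (fun _ : Fin k => E d) j‖ ≤ 1 :=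
      ContinuousLinearMap.opNorm_le_bound _ zero_le_one fun v => by simp [Pi.norm_single]
    exact (mul_le_of_le_one_right (norm_nonneg _) h1).trans (hM _)
  refine (Finset.sum_le_sum fun j _ => this j).trans ?_
  simp

lemma hasFDerivAt_polyPotential (hΘ : ContDiff ℝ 1 Θ) (hc : HasCompactSupport Θ) (m : P2 d)
    (q : E d) : HasFDerivAt (polyPotential Θ m)
      (∫ x, updateDeriv Θ q x ∂(Measure.pi fun _ : Fin k => m.toMeasure)) q := by
  obtain ⟨M, -, hM⟩ := exists_norm_fderiv_le hΘ hc
  obtain ⟨M', hM'⟩ := hc.exists_bound_of_continuous hΘ.continuous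
  have hcont := hΘ.continuous
  refine hasFDerivAt_integral_of_dominated_of_fderiv_le (s := Set.univ) (bound := fun _ => k * M)
    univ_mem (Eventually.of_forall fun q => ?_) ?_ ?_
    (Eventually.of_forall fun x q _ => norm_updateDeriv_le hM q x)
    (integrable_const _) (Eventually.of_forall fun x q _ => hasFDerivAt_sum_update hΘ x q)
  · exact Continuous.aestronglyMeasurable (by fun_prop)
  · refine integrable_finsetSum _ fun j _ => Integrable.of_bound
      (Continuous.aestronglyMeasurable (by fun_prop)) M' (Eventually.of_forall fun x => hM' _)
  · exact ((continuous_updateDeriv hΘ).comp (Continuous.prodMk_right q)).aestronglyMeasurable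

lemma contDiff_polyPotential (hΘ : ContDiff ℝ 1 Θ) (hc : HasCompactSupport Θ) (m : P2 d) :
    ContDiff ℝ 1 (polyPotential Θ m) := by
  obtain ⟨M, -, hM⟩ := exists_norm_fderiv_le hΘ hc
  rw [contDiff_one_iff_fderiv]
  refine ⟨fun q => (hasFDerivAt_polyPotential hΘ hc m q).differentiableAt, ?_⟩
  have : fderiv ℝ (polyPotential Θ m) = fun q =>
      ∫ x, updateDeriv Θ q x ∂(Measure.pi fun _ : Fin k => m.toMeasure) :=
    funext fun q => (hasFDerivAt_polyPotential hΘ hc m q).fderiv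
  rw [this]
  refine continuous_of_dominated (bound := fun _ => k * M) (fun q => ?_)
    (fun q => Eventually.of_forall fun x => norm_updateDeriv_le hM q x) (integrable_const _)
    (Eventually.of_forall fun x => ?_)
  · exact ((continuous_updateDeriv hΘ).comp (Continuous.prodMk_right q)).aestronglyMeasurable
  · exact (continuous_updateDeriv hΘ).comp (Continuous.prodMk_left x)

/-- The Wasserstein gradient of `polyInt Θ`. -/
def polyGrad (hΘ : ContDiff ℝ 1 Θ) (hc : HasCompactSupport Θ) (m : P2 d) :
    Lp (E d) 2 m.toMeasure :=
  (memLp_gradient (contDiff_polyPotential hΘ hc m) (hasCompactSupport_polyPotential hc m)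
    m.toMeasure).toLp _

lemma polyGrad_mem_tangent (hΘ : ContDiff ℝ 1 Θ) (hc : HasCompactSupport Θ) (m : P2 d) :
    polyGrad hΘ hc m ∈ tangent m :=
  toLp_gradient_mem_tangent m (contDiff_polyPotential hΘ hc m) (hasCompactSupport_polyPotential hc m)

lemma coeFn_polyGrad (hΘ : ContDiff ℝ 1 Θ) (hc : HasCompactSupport Θ) (m : P2 d) :
    polyGrad hΘ hc m =ᵐ[m.toMeasure] gradient (polyPotential Θ m) :=
  MemLp.coeFn_toLp _

/-- The abstract space `X` with its map `π` serves two cases: a plan on `E d × E d` with the first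
projection and `B` the displacement, and `m` itself with the identity and `B` a vector field. -/
lemma integrable_fderiv_apply_comp {X : Type*} [MeasurableSpace X] {γ : Measure X}
    [IsProbabilityMeasure γ] (hΘ : ContDiff ℝ 1 Θ) (hc : HasCompactSupport Θ) {π : X → E d}
    (hπ : Measurable π) {B : X → E d} (hB : Integrable B γ) (j : Fin k) :
    Integrable (fun p : Fin k → X => fderiv ℝ Θ (fun i => π (p i)) (Pi.single j (B (p j))))
      (Measure.pi fun _ => γ) := by
  obtain ⟨M, hM0, hM⟩ := exists_norm_fderiv_le hΘ hc
  have hBj : Integrable (fun p : Fin k → X => B (p j)) (Measure.pi fun _ => γ) :=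
    (measurePreserving_eval (fun _ : Fin k => γ) j).integrable_comp_of_integrable hB
  have hm : Measurable fun p : Fin k → X => fun i => π (p i) := by fun_prop
  have h1 : AEStronglyMeasurable (fun p : Fin k → X => fderiv ℝ Θ (fun i => π (p i)))
      (Measure.pi fun _ => γ) :=
    ((hΘ.continuous_fderiv (by norm_num)).comp_stronglyMeasurable
      hm.stronglyMeasurable).aestronglyMeasurable
  have h2 : AEStronglyMeasurable (fun p : Fin k → X =>
      (Pi.single j (B (p j)) : Fin k → E d)) (Measure.pi fun _ => γ) :=
    (ContinuousLinearMap.single ℝ (fun _ : Fin k => E d) j).continuous.comp_aestronglyMeasurable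
      hBj.aestronglyMeasurable
  refine (hBj.norm.const_mul M).mono
    (isBoundedBilinearMap_apply.continuous.comp_aestronglyMeasurable₂ h1 h2)
    (Eventually.of_forall fun p => ?_)
  refine (ContinuousLinearMap.le_opNorm _ _).trans ?_
  rw [norm_mul, Real.norm_of_nonneg hM0, norm_norm, Pi.norm_single]
  exact mul_le_mul_of_nonneg_right (hM _) (norm_nonneg _)

lemma fderiv_apply_comp_eq_sum {X : Type*} (π B : X → E d) (p : Fin k → X) :
    fderiv ℝ Θ (fun i => π (p i)) (fun i => B (p i)) =
      ∑ j, fderiv ℝ Θ (fun i => π (p i)) (Pi.single j (B (p j))) := by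
  rw [← map_sum, Finset.univ_sum_single (fun i => B (p i))]

/-- Pairing of the gradient of the potential with a vector field, in Lagrangian coordinates. -/
lemma integral_inner_gradient_polyPotential {X : Type*} [MeasurableSpace X] {γ : Measure X}
    [IsProbabilityMeasure γ] (hΘ : ContDiff ℝ 1 Θ) (hc : HasCompactSupport Θ) {m : P2 d}
    {π : X → E d} (hπ : MeasurePreserving π γ m.toMeasure) {B : X → E d} (hB : Integrable B γ) :
    ∫ q, inner ℝ (gradient (polyPotential Θ m) (π q)) (B q) ∂γ =
      ∫ p, fderiv ℝ Θ (fun i => π (p i)) (fun i => B (p i)) ∂(Measure.pi fun _ : Fin k => γ) := by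
  obtain ⟨M, hM0, hM⟩ := exists_norm_fderiv_le hΘ hc
  have hpi : MeasurePreserving (fun p : Fin k → X => fun i => π (p i))
      (Measure.pi fun _ => γ) (Measure.pi fun _ => m.toMeasure) :=
    measurePreserving_pi (fun _ => γ) (fun _ => m.toMeasure) fun _ => hπ
  have hF := fun j => integrable_fderiv_apply_comp (Θ := Θ) hΘ hc hπ.measurable hB j
  have hcomp : ∀ j, Integrable (fun z : (Fin k → X) × X =>
      fderiv ℝ Θ (fun i => π (Function.update z.1 j z.2 i)) (Pi.single j (B z.2)))
      ((Measure.pi fun _ => γ).prod γ) := by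
    intro j
    have := (measurePreserving_update γ j).integrable_comp_of_integrable (hF j)
    simpa [Function.comp_def] using this
  have hupd : ∀ (p : Fin k → X) (q : X) (j : Fin k),
      (fun i => π (Function.update p j q i)) = Function.update (fun i => π (p i)) j (π q) := by
    intro p q j
    funext i
    by_cases h : i = j
    · subst h; simp
    · simp [h]
  have h1 : ∀ q, inner ℝ (gradient (polyPotential Θ m) (π q)) (B q) =
      ∫ p, ∑ j, fderiv ℝ Θ (fun i => π (Function.update p j q i)) (Pi.single j (B q))
        ∂(Measure.pi fun _ : Fin k => γ) := by
    intro q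
    rw [inner_gradient_eq_fderiv, (hasFDerivAt_polyPotential hΘ hc m (π q)).fderiv,
      ContinuousLinearMap.integral_apply]
    · have hcont : Continuous fun x => updateDeriv Θ (π q) x (B q) :=
        ((continuous_updateDeriv hΘ).comp (Continuous.prodMk_right (π q))).clm_apply
          continuous_const
      rw [← hpi.integral_comp_of_aestronglyMeasurable hcont.aestronglyMeasurable]
      refine integral_congr_ae (Eventually.of_forall fun p => ?_)
      simp only [updateDeriv, sum_apply, ContinuousLinearMap.comp_apply,
        ContinuousLinearMap.single_apply, hupd]
    · refine Integrable.of_bound ((continuous_updateDeriv hΘ).comp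
        (Continuous.prodMk_right (π q))).aestronglyMeasurable (k * M)
        (Eventually.of_forall fun x => norm_updateDeriv_le hM _ x)
  have h2 : ∀ p : Fin k → X, fderiv ℝ Θ (fun i => π (p i)) (fun i => B (p i)) =
      ∑ j, fderiv ℝ Θ (fun i => π (p i)) (Pi.single j (B (p j))) :=
    fderiv_apply_comp_eq_sum π B
  simp_rw [h1, h2]
  rw [integral_finsetSum _ fun j _ => hF j,
    ← integral_prod_symm (f := fun z : (Fin k → X) × X => ∑ j,
      fderiv ℝ Θ (fun i => π (Function.update z.1 j z.2 i)) (Pi.single j (B z.2)))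
      (integrable_finsetSum _ fun j _ => hcomp j),
    integral_finsetSum _ fun j _ => hcomp j]
  -- Placing the extra independent variable `q` in the `j`-th slot gives a sample of the same
  -- product law, so the double integral collapses to one over `p`.
  refine Finset.sum_congr rfl fun j _ => ?_
  rw [← (measurePreserving_update γ j).integral_comp_of_aestronglyMeasurable
    (hF j).aestronglyMeasurable]
  simp

/-- The product of `k` copies of `γ` couples `m^k` with `ν^k`. Taylor's formula is integrated
against it; the squared sup norm of the displacement is at most the sum of the `k` squared
displacements, each of mean equal to the cost, whence `C * k`. -/
theorem hasQuadExpansionAt_polyInt (hΘ : ContDiff ℝ 2 Θ) (hc : HasCompactSupport Θ) (m : P2 d) :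
    HasQuadExpansionAt (polyInt Θ) m (polyGrad (hΘ.of_le one_le_two) hc m) := by
  obtain ⟨C, hC, hT⟩ := hΘ.exists_quadratic_remainder hc
  obtain ⟨M', hM'⟩ := hc.exists_bound_of_continuous hΘ.continuous
  have hΘ1 : ContDiff ℝ 1 Θ := hΘ.of_le one_le_two
  refine ⟨C * k, by positivity, fun ν γ hγ => ?_⟩
  have := isProbabilityMeasure_of_mem_plans hγ
  have hfst := measurePreserving_fst_of_mem_plans hγ
  have hsnd := measurePreserving_snd_of_mem_plans hγ
  have hsub := memLp_sub_of_mem_plans hγ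
  have hpf : MeasurePreserving (fun p : Fin k → E d × E d => fun i => (p i).1)
      (Measure.pi fun _ => γ) (Measure.pi fun _ => m.toMeasure) :=
    measurePreserving_pi (fun _ => γ) (fun _ => m.toMeasure) fun _ => hfst
  have hps : MeasurePreserving (fun p : Fin k → E d × E d => fun i => (p i).2)
      (Measure.pi fun _ => γ) (Measure.pi fun _ => ν.toMeasure) :=
    measurePreserving_pi (fun _ => γ) (fun _ => ν.toMeasure) fun _ => hsnd
  have hcont := hΘ.continuous
  have hg : ∫ p, inner ℝ (polyGrad hΘ1 hc m p.1) (p.2 - p.1) ∂γ =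
      ∫ p, fderiv ℝ Θ (fun i => (p i).1) (fun i => (p i).2 - (p i).1)
        ∂(Measure.pi fun _ : Fin k => γ) := by
    rw [← integral_inner_gradient_polyPotential hΘ1 hc hfst (hsub.integrable one_le_two)]
    refine integral_congr_ae ?_
    filter_upwards [hfst.quasiMeasurePreserving.ae_eq_comp (coeFn_polyGrad hΘ1 hc m)] with p hp
    simp only [Function.comp] at hp
    rw [hp]
  have hi1 : Integrable (fun p : Fin k → E d × E d => Θ fun i => (p i).1)
      (Measure.pi fun _ => γ) := Integrable.of_bound
        (hcont.measurable.comp hpf.measurable).aestronglyMeasurable M'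
        (Eventually.of_forall fun p => hM' _)
  have hi2 : Integrable (fun p : Fin k → E d × E d => Θ fun i => (p i).2)
      (Measure.pi fun _ => γ) := Integrable.of_bound
        (hcont.measurable.comp hps.measurable).aestronglyMeasurable M'
        (Eventually.of_forall fun p => hM' _)
  have hi3 : Integrable (fun p : Fin k → E d × E d =>
      fderiv ℝ Θ (fun i => (p i).1) (fun i => (p i).2 - (p i).1)) (Measure.pi fun _ => γ) := by
    simp_rw [fun p : Fin k → E d × E d => fderiv_apply_comp_eq_sum (Θ := Θ)
      (fun q : E d × E d => q.1) (fun q => q.2 - q.1) p]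
    exact integrable_finsetSum _ fun j _ => integrable_fderiv_apply_comp hΘ1 hc
      measurable_fst (hsub.integrable one_le_two) j
  have hsq : Integrable (fun p : E d × E d => ‖p.2 - p.1‖ ^ 2) γ :=
    hsub.integrable_norm_pow (by simp)
  have hi4 : ∀ j, Integrable (fun p : Fin k → E d × E d => ‖(p j).2 - (p j).1‖ ^ 2)
      (Measure.pi fun _ => γ) := fun j =>
    (measurePreserving_eval (fun _ : Fin k => γ) j).integrable_comp_of_integrable hsq
  have hU1 : polyInt Θ m = ∫ p, Θ (fun i => (p i).1) ∂(Measure.pi fun _ : Fin k => γ) :=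
    (hpf.integral_comp_of_aestronglyMeasurable hcont.aestronglyMeasurable).symm
  have hU2 : polyInt Θ ν = ∫ p, Θ (fun i => (p i).2) ∂(Measure.pi fun _ : Fin k => γ) :=
    (hps.integral_comp_of_aestronglyMeasurable hcont.aestronglyMeasurable).symm
  have hi21 : Integrable (fun p : Fin k → E d × E d => Θ (fun i => (p i).2) -
      Θ fun i => (p i).1) (Measure.pi fun _ => γ) := hi2.sub hi1
  rw [hg, hU1, hU2, ← integral_sub hi2 hi1, ← integral_sub hi21 hi3]
  refine (abs_integral_le_integral_abs).trans ?_
  have hbound : ∀ p : Fin k → E d × E d,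
      |Θ (fun i => (p i).2) - Θ (fun i => (p i).1) -
        fderiv ℝ Θ (fun i => (p i).1) (fun i => (p i).2 - (p i).1)| ≤
      C * ∑ j, ‖(p j).2 - (p j).1‖ ^ 2 := by
    intro p
    refine (hT (fun i => (p i).1) (fun i => (p i).2)).trans ?_
    gcongr
    have hn : ‖(fun i => (p i).2) - (fun i => (p i).1)‖ ≤
        √(∑ j, ‖(p j).2 - (p j).1‖ ^ 2) := by
      refine (pi_norm_le_iff_of_nonneg (Real.sqrt_nonneg _)).2 fun j => ?_
      refine Real.le_sqrt_of_sq_le ?_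
      exact Finset.single_le_sum (f := fun j => ‖(p j).2 - (p j).1‖ ^ 2)
        (fun i _ => by positivity) (Finset.mem_univ j)
    calc _ ≤ √(∑ j, ‖(p j).2 - (p j).1‖ ^ 2) ^ 2 := by gcongr
      _ = _ := Real.sq_sqrt (Finset.sum_nonneg fun i _ => by positivity)
  refine (integral_mono (hi21.sub hi3).abs
    ((integrable_finsetSum _ fun j _ => hi4 j).const_mul C) hbound).trans_eq ?_
  rw [integral_const_mul, integral_finsetSum _ fun j _ => hi4 j, mul_assoc]
  congr 1
  have : ∀ j : Fin k, ∫ p, ‖(p j).2 - (p j).1‖ ^ 2 ∂(Measure.pi fun _ : Fin k => γ) =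
      ∫ p, ‖p.2 - p.1‖ ^ 2 ∂γ := fun j =>
    (measurePreserving_eval (fun _ : Fin k => γ) j).integral_comp_of_aestronglyMeasurable
      (f := fun p : E d × E d => ‖p.2 - p.1‖ ^ 2) hsq.aestronglyMeasurable
  simp [this]

lemma wGrad_polyInt (hΘ : ContDiff ℝ 2 Θ) (hc : HasCompactSupport Θ) (m : P2 d) :
    wGrad (polyInt Θ) m = polyGrad (hΘ.of_le one_le_two) hc m :=
  (hasQuadExpansionAt_polyInt hΘ hc m).wGrad_eq (polyGrad_mem_tangent _ _ _)

/-- The derivative of `polyInt Θ` along a vector field. -/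
theorem dirDeriv_polyInt (hΘ : ContDiff ℝ 2 Θ) (hc : HasCompactSupport Θ) (m : P2 d)
    {ζ : E d → E d} (hζ : Integrable ζ m.toMeasure) :
    dirDeriv ζ (polyInt Θ) m = polyInt (fun x => fderiv ℝ Θ x fun i => ζ (x i)) m := by
  have hΘ1 : ContDiff ℝ 1 Θ := hΘ.of_le one_le_two
  rw [dirDeriv, wGrad_polyInt hΘ hc, polyInt]
  have := integral_inner_gradient_polyPotential hΘ1 hc (MeasurePreserving.id m.toMeasure) hζ
  simp only [id] at this
  rw [← this]
  refine integral_congr_ae ?_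
  filter_upwards [coeFn_polyGrad hΘ1 hc m] with x hx
  rw [hx]

end Wasserstein

namespace Wasserstein

/-! ### Moments -/

variable {d : ℕ}

lemma gradient_const_mul_comp_smul {φ : E d → ℝ} (hφ : Differentiable ℝ φ) {c : ℝ} (hc : c ≠ 0)
    (x : E d) : gradient (fun y => c⁻¹ * φ (c • y)) x = gradient φ (c • x) := by
  have h1 : HasFDerivAt (fun y : E d => c⁻¹ * φ (c • y))
      (c⁻¹ • (fderiv ℝ φ (c • x)).comp (c • ContinuousLinearMap.id ℝ (E d))) x :=
    ((hφ (c • x)).hasFDerivAt.comp x ((hasFDerivAt_id x).const_smul c)).const_mul _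
  rw [gradient, gradient, h1.fderiv]
  congr 1
  ext v
  simp [hc]

/-- Constant vector fields are tangent. -/
lemma toLp_const_mem_tangent (m : P2 d) (u : E d) :
    (memLp_const u : MemLp (fun _ : E d => u) 2 m.toMeasure).toLp _ ∈ tangent m := by
  -- `φ` is the linear function `⟨u, x⟩` cut off near the origin. The dilations `(n+1) φ(x/(n+1))`
  -- have gradients `∇φ(x/(n+1))`, uniformly bounded and converging pointwise to `∇φ(0) = u`.
  let χ : ContDiffBump (0 : E d) := ⟨1, 2, one_pos, one_lt_two⟩
  let φ : E d → ℝ := fun x => χ x * inner ℝ u x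
  have hφ : ContDiff ℝ ∞ φ := χ.contDiff.mul (contDiff_const.inner ℝ contDiff_id)
  have hφc : HasCompactSupport φ := χ.hasCompactSupport.mul_right
  have hφ1 : ContDiff ℝ 1 φ := contDiff_infty.1 hφ 1
  have hgc : Continuous (gradient φ) := continuous_gradient hφ1
  have hu : gradient φ 0 = u := by
    have h1 : φ =ᶠ[𝓝 0] fun x => inner ℝ u x := by
      filter_upwards [χ.eventuallyEq_one] with x hx
      simp [φ, hx]
    rw [gradient, h1.fderiv_eq]
    have : (fun x : E d => (inner ℝ u x : ℝ)) = innerSL ℝ u := rfl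
    rw [this, ContinuousLinearMap.fderiv]
    exact (InnerProductSpace.toDual ℝ (E d)).symm_apply_apply u
  obtain ⟨M, hM⟩ := (hasCompactSupport_gradient hφc).exists_bound_of_continuous hgc
  -- With the closure written as a double orthogonal, weak convergence of these gradients suffices,
  -- and this is dominated convergence.
  rw [tangent, ← Submodule.orthogonal_orthogonal_eq_closure, Submodule.mem_orthogonal]
  intro w hw
  have hn : ∀ n : ℕ, ∫ x, inner ℝ (gradient φ (((n : ℝ) + 1)⁻¹ • x)) (w x) ∂m.toMeasure = 0 := by
    intro n
    have hc : ((n : ℝ) + 1)⁻¹ ≠ 0 := by positivity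
    let ψ : E d → ℝ := fun y => (((n : ℝ) + 1)⁻¹)⁻¹ * φ (((n : ℝ) + 1)⁻¹ • y)
    have hψ : ContDiff ℝ ∞ ψ := contDiff_const.mul (hφ.comp (contDiff_const_smul _))
    have hψc : HasCompactSupport ψ := (hφc.comp_smul hc).mul_left
    have hmem := memLp_gradient (contDiff_infty.1 hψ 1) hψc m.toMeasure
    have h0 := Submodule.mem_orthogonal _ w |>.1 hw (hmem.toLp _)
      (Submodule.subset_span ⟨ψ, hψ, hψc, MemLp.coeFn_toLp _⟩)
    rw [L2.inner_def] at h0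
    rw [← h0]
    refine integral_congr_ae ?_
    filter_upwards [hmem.coeFn_toLp] with x hx
    rw [hx, gradient_const_mul_comp_smul (hφ.differentiable (by simp)) hc]
  have hw1 : Integrable (fun x => M * ‖w x‖) m.toMeasure :=
    (((Lp.memLp w).integrable one_le_two).norm).const_mul M
  have hlim := tendsto_integral_of_dominated_convergence (μ := m.toMeasure)
    (F := fun (n : ℕ) x => (inner ℝ (gradient φ (((n : ℝ) + 1)⁻¹ • x)) (w x) : ℝ))
    (f := fun x => inner ℝ u (w x)) (fun x => M * ‖w x‖)
    (fun n => (Continuous.aestronglyMeasurable (by fun_prop)).inner (Lp.aestronglyMeasurable w))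
    hw1 (fun n => Eventually.of_forall fun x => (norm_inner_le_norm _ _).trans
      (mul_le_mul_of_nonneg_right (hM _) (norm_nonneg _)))
    (Eventually.of_forall fun x => by
      have h1 : Tendsto (fun n : ℕ => gradient φ (((n : ℝ) + 1)⁻¹ • x)) atTop (𝓝 u) := by
        rw [← hu]
        refine (hgc.tendsto 0).comp ?_
        have h2 : Tendsto (fun n : ℕ => ((n : ℝ) + 1)⁻¹) atTop (𝓝 0) :=
          tendsto_inv_atTop_zero.comp (tendsto_natCast_atTop_atTop.atTop_add tendsto_const_nhds)
        simpa using h2.smul_const x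
      exact h1.inner tendsto_const_nhds)
  simp_rw [hn] at hlim
  have hzero := tendsto_nhds_unique hlim tendsto_const_nhds
  rw [L2.inner_def, ← hzero]
  refine integral_congr_ae ?_
  filter_upwards [(memLp_const u : MemLp (fun _ : E d => u) 2 m.toMeasure).coeFn_toLp] with x hx
  rw [hx, real_inner_comm]

/-- The `i`-th coordinate field, as an element of the tangent space. -/
def coordTangent (m : P2 d) (i : Fin d) : tangent m :=
  ⟨(memLp_const (EuclideanSpace.single i (1 : ℝ)) : MemLp (fun _ : E d =>
    EuclideanSpace.single i (1 : ℝ)) 2 m.toMeasure).toLp _,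
    toLp_const_mem_tangent m (EuclideanSpace.single i 1)⟩

lemma coeFn_coordTangent (m : P2 d) (i : Fin d) :
    ((coordTangent m i : Lp (E d) 2 m.toMeasure) : E d → E d) =ᵐ[m.toMeasure]
      fun _ => EuclideanSpace.single i 1 :=
  MemLp.coeFn_toLp (memLp_const (EuclideanSpace.single i (1 : ℝ)))

/-- The moment is linear in the measure and in the position, so the expansion is exact and the
constant is `0`. -/
lemma hasQuadExpansionAt_moment (i : Fin d) (m : P2 d) :
    HasQuadExpansionAt (moment i) m (coordTangent m i : Lp (E d) 2 m.toMeasure) := by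
  refine ⟨0, le_rfl, fun ν γ hγ => ?_⟩
  have hfst := measurePreserving_fst_of_mem_plans hγ
  have hsnd := measurePreserving_snd_of_mem_plans hγ
  have := isProbabilityMeasure_of_mem_plans hγ
  have hx : ∀ μ : P2 d, Integrable (fun x : E d => x i) μ.toMeasure := fun μ =>
    (EuclideanSpace.proj (𝕜 := ℝ) i).integrable_comp ((memLp_id μ).integrable one_le_two)
  have h1 : moment i m = ∫ p, p.1 i ∂γ :=
    (hfst.integral_comp_of_aestronglyMeasurable (hx m).aestronglyMeasurable).symm
  have h2 : moment i ν = ∫ p, p.2 i ∂γ :=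
    (hsnd.integral_comp_of_aestronglyMeasurable (hx ν).aestronglyMeasurable).symm
  have h3 : ∫ p, inner ℝ ((coordTangent m i : Lp (E d) 2 m.toMeasure) p.1) (p.2 - p.1) ∂γ =
      ∫ p, (p.2 i - p.1 i) ∂γ := by
    refine integral_congr_ae ?_
    filter_upwards [hfst.quasiMeasurePreserving.ae_eq_comp (coeFn_coordTangent m i)] with p hp
    rw [Function.comp_apply, Function.comp_apply] at hp
    rw [hp, EuclideanSpace.inner_single_left]
    simp
  have h4 : Integrable (fun p : E d × E d => p.2 i) γ :=
    hsnd.integrable_comp_of_integrable (hx ν)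
  have h5 : Integrable (fun p : E d × E d => p.1 i) γ :=
    hfst.integrable_comp_of_integrable (hx m)
  rw [h1, h2, h3, integral_sub h4 h5]
  simp

/-! ### The Hessian of a polynomial functional -/

lemma integral_norm_mul_norm_le {X F : Type*} [MeasurableSpace X] [NormedAddCommGroup F]
    {μ : Measure X} (f g : Lp F 2 μ) : ∫ x, ‖f x‖ * ‖g x‖ ∂μ ≤ ‖f‖ * ‖g‖ := by
  have hf := (Lp.memLp f).norm
  have hg := (Lp.memLp g).norm
  have h1 : ‖hf.toLp _‖ = ‖f‖ := by rw [Lp.norm_toLp, eLpNorm_norm, Lp.norm_def]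
  have h2 : ‖hg.toLp _‖ = ‖g‖ := by rw [Lp.norm_toLp, eLpNorm_norm, Lp.norm_def]
  rw [← h1, ← h2]
  refine le_of_eq_of_le ?_ (real_inner_le_norm (hf.toLp _) (hg.toLp _))
  rw [L2.inner_def]
  refine integral_congr_ae ?_
  filter_upwards [hf.coeFn_toLp, hg.coeFn_toLp] with x hx1 hx2
  rw [hx1, hx2]
  simp [mul_comm]

/-! ### Bounded bilinear forms on `L²` and lifting of fields to `(ℝ^d)^k`. -/

variable {X V : Type*} [MeasurableSpace X] [NormedAddCommGroup V] [NormedSpace ℝ V] {μ : Measure X}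

lemma integrable_bilin_apply {A : X → V →L[ℝ] V →L[ℝ] ℝ}
    (hA : AEStronglyMeasurable A μ) {M : ℝ} (hM : ∀ x, ‖A x‖ ≤ M) (a b : Lp V 2 μ) :
    Integrable (fun x => A x (a x) (b x)) μ := by
  have hab : Integrable (fun x => ‖a x‖ * ‖b x‖) μ := by
    refine ((Lp.memLp a).norm.integrable_inner_two (Lp.memLp b).norm).congr
      (Eventually.of_forall fun x => ?_)
    simp [mul_comm]
  refine (hab.const_mul M).mono' ?_ (Eventually.of_forall fun x => ?_)
  · exact isBoundedBilinearMap_apply.continuous.comp_aestronglyMeasurable₂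
      (isBoundedBilinearMap_apply.continuous.comp_aestronglyMeasurable₂ hA
        (Lp.aestronglyMeasurable a)) (Lp.aestronglyMeasurable b)
  · refine ((A x).le_opNorm₂ _ _).trans ?_
    rw [mul_assoc]
    exact mul_le_mul_of_nonneg_right (hM x) (by positivity)

/-- The bounded bilinear form `(a, b) ↦ ∫ A(x)(a(x), b(x)) μ(dx)` on `L²(μ)`. -/
def integralBilin {A : X → V →L[ℝ] V →L[ℝ] ℝ} (hA : AEStronglyMeasurable A μ) {M : ℝ}
    (hM : ∀ x, ‖A x‖ ≤ M) : Lp V 2 μ →L[ℝ] Lp V 2 μ →L[ℝ] ℝ :=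
  LinearMap.mkContinuous₂ (LinearMap.mk₂ ℝ (fun a b : Lp V 2 μ => ∫ x, A x (a x) (b x) ∂μ)
    (fun a a' b => by
      rw [← integral_add (integrable_bilin_apply hA hM a b) (integrable_bilin_apply hA hM a' b)]
      refine integral_congr_ae ?_
      filter_upwards [Lp.coeFn_add a a'] with x hx
      rw [hx]; simp)
    (fun c a b => by
      rw [smul_eq_mul, ← integral_const_mul]
      refine integral_congr_ae ?_
      filter_upwards [Lp.coeFn_smul c a] with x hx
      rw [hx]; simp)
    (fun a b b' => by
      rw [← integral_add (integrable_bilin_apply hA hM a b) (integrable_bilin_apply hA hM a b')]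
      refine integral_congr_ae ?_
      filter_upwards [Lp.coeFn_add b b'] with x hx
      rw [hx]; simp)
    (fun c a b => by
      rw [smul_eq_mul, ← integral_const_mul]
      refine integral_congr_ae ?_
      filter_upwards [Lp.coeFn_smul c b] with x hx
      -- `max M 0`, since `hM` does not force `M ≥ 0` when `X` is empty.
      rw [hx]; simp)) (max M 0) (fun a b => by
    have hab : Integrable (fun x => ‖a x‖ * ‖b x‖) μ := by
      refine ((Lp.memLp a).norm.integrable_inner_two (Lp.memLp b).norm).congr
        (Eventually.of_forall fun x => ?_)
      simp [mul_comm]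
    refine (norm_integral_le_of_norm_le (hab.const_mul (max M 0))
      (Eventually.of_forall fun x => ?_)).trans ?_
    · refine ((A x).le_opNorm₂ _ _).trans ?_
      rw [mul_assoc]
      exact mul_le_mul_of_nonneg_right ((hM x).trans (le_max_left _ _)) (by positivity)
    · rw [integral_const_mul, mul_assoc]
      exact mul_le_mul_of_nonneg_left (integral_norm_mul_norm_le a b) (le_max_right _ _))

lemma integralBilin_apply {A : X → V →L[ℝ] V →L[ℝ] ℝ} (hA : AEStronglyMeasurable A μ) {M : ℝ}
    (hM : ∀ x, ‖A x‖ ≤ M) (a b : Lp V 2 μ) :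
    integralBilin hA hM a b = ∫ x, A x (a x) (b x) ∂μ := rfl

/-- The map sending a field `z` on `ℝ^d` to the field `x ↦ (z(x₁), …, z(x_k))` on `(ℝ^d)^k`. -/
def diagLift (k : ℕ) (m : P2 d) :
    Lp (E d) 2 m.toMeasure →L[ℝ] Lp (Fin k → E d) 2 (Measure.pi fun _ : Fin k => m.toMeasure) :=
  ∑ i, ((ContinuousLinearMap.single ℝ (fun _ : Fin k => E d) i).compLpL 2 _).comp
    (Lp.compMeasurePreservingₗᵢ ℝ (Function.eval i)
      (measurePreserving_eval (fun _ : Fin k => m.toMeasure) i)).toContinuousLinearMap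

lemma coeFn_diagLift {k : ℕ} (m : P2 d) {z : Lp (E d) 2 m.toMeasure} {ζ : E d → E d}
    (hz : z =ᵐ[m.toMeasure] ζ) :
    diagLift k m z =ᵐ[Measure.pi fun _ : Fin k => m.toMeasure] fun x i => ζ (x i) := by
  have h1 : ∀ i : Fin k, (((ContinuousLinearMap.single ℝ (fun _ : Fin k => E d) i).compLpL 2 _)
      (Lp.compMeasurePreserving (Function.eval i)
        (measurePreserving_eval (fun _ : Fin k => m.toMeasure) i) z) :
        (Fin k → E d) → Fin k → E d)
      =ᵐ[Measure.pi fun _ : Fin k => m.toMeasure] fun x => Pi.single i (ζ (x i)) := by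
    intro i
    have hp := measurePreserving_eval (fun _ : Fin k => m.toMeasure) i
    filter_upwards [ContinuousLinearMap.coeFn_compLpL (𝕜 := ℝ)
      (ContinuousLinearMap.single ℝ (fun _ : Fin k => E d) i)
      (Lp.compMeasurePreserving (Function.eval i) hp z), Lp.coeFn_compMeasurePreserving z hp,
      hp.quasiMeasurePreserving.ae_eq_comp hz] with x h1 h2 h3
    rw [h1, h2, h3]
    simp
  have h2 : diagLift k m z = ∑ i,
      ((ContinuousLinearMap.single ℝ (fun _ : Fin k => E d) i).compLpL 2 _)
      (Lp.compMeasurePreserving (Function.eval i)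
        (measurePreserving_eval (fun _ : Fin k => m.toMeasure) i) z) := by
    rw [diagLift, sum_apply]
    rfl
  rw [h2]
  filter_upwards [Lp.coeFn_finsetSum Finset.univ fun i =>
    ((ContinuousLinearMap.single ℝ (fun _ : Fin k => E d) i).compLpL 2 _)
      (Lp.compMeasurePreserving (Function.eval i)
        (measurePreserving_eval (fun _ : Fin k => m.toMeasure) i) z), ae_all_iff.2 h1] with x hx h
  rw [hx, Finset.sum_apply, Finset.sum_congr rfl fun i _ => h i, Finset.univ_sum_single (fun i => ζ (x i))]

end Wasserstein

/-! ### Existence of the Hessian of a polynomial functional. -/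

namespace Wasserstein

variable {d k : ℕ} {Θ : (Fin k → E d) → ℝ}

lemma contDiff_fderiv_apply_comp {n : ℕ} (hΘ : ContDiff ℝ (n + 1) Θ) {ζ : E d → E d}
    (hζ : ContDiff ℝ ∞ ζ) : ContDiff ℝ n fun x => fderiv ℝ Θ x fun i => ζ (x i) := by
  refine (hΘ.fderiv_right le_rfl).clm_apply (contDiff_pi.2 fun i => ?_)
  exact (contDiff_infty.1 hζ n).comp (contDiff_apply ℝ (E d) i)

lemma hasCompactSupport_fderiv_apply (hc : HasCompactSupport Θ)
    (Z : (Fin k → E d) → Fin k → E d) : HasCompactSupport fun x => fderiv ℝ Θ x (Z x) := by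
  refine (hc.fderiv ℝ).mono fun x hx => ?_
  intro h
  simp [h] at hx

/-- Product rule. For `v = (ζ₁(x_i))_i` the second term is the correction `(∇ζ₂ ζ₁)·U` subtracted in
the Hessian; the first contains no derivative of the fields and can therefore be bounded in `L²`. -/
lemma fderiv_fderiv_apply_comp (hΘ : ContDiff ℝ 2 Θ) {ζ : E d → E d} (hζ : Differentiable ℝ ζ)
    (x v : Fin k → E d) :
    fderiv ℝ (fun x => fderiv ℝ Θ x fun i => ζ (x i)) x v =
      fderiv ℝ (fderiv ℝ Θ) x v (fun i => ζ (x i)) +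
        fderiv ℝ Θ x fun i => fderiv ℝ ζ (x i) (v i) := by
  have h1 : HasFDerivAt (fderiv ℝ Θ) (fderiv ℝ (fderiv ℝ Θ) x) x :=
    (((hΘ.fderiv_right (m := 1) (by norm_num)).differentiable (by norm_num)) x).hasFDerivAt
  have h2 : HasFDerivAt (fun (x : Fin k → E d) (i : Fin k) => ζ (x i))
      (ContinuousLinearMap.pi fun i =>
        (fderiv ℝ ζ (x i)).comp (ContinuousLinearMap.proj (R := ℝ) (φ := fun _ => E d) i)) x :=
    hasFDerivAt_pi.2 fun i => (hζ (x i)).hasFDerivAt.comp x (hasFDerivAt_apply i x)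
  rw [(h1.clm_apply h2).fderiv]
  simp only [add_apply, ContinuousLinearMap.comp_apply, ContinuousLinearMap.flip_apply]
  rw [add_comm]
  rfl

lemma integrable_pi_of_continuous_hasCompactSupport {f : (Fin k → E d) → ℝ} (hf : Continuous f)
    (hc : HasCompactSupport f) (m : P2 d) :
    Integrable f (Measure.pi fun _ : Fin k => m.toMeasure) := by
  obtain ⟨M, hM⟩ := hc.exists_bound_of_continuous hf
  exact Integrable.of_bound hf.aestronglyMeasurable M (Eventually.of_forall hM)

lemma continuous_fderiv_fderiv (hΘ : ContDiff ℝ 2 Θ) : Continuous (fderiv ℝ (fderiv ℝ Θ)) :=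
  (hΘ.fderiv_right (m := 1) (by norm_num)).continuous_fderiv (by norm_num)

lemma _root_.HasCompactSupport.exists_norm_fderiv_le {V F : Type*} [NormedAddCommGroup V]
    [NormedSpace ℝ V] [NormedAddCommGroup F] [NormedSpace ℝ F] {f : V → F}
    (hc : HasCompactSupport f) (hf : Continuous (fderiv ℝ f)) : ∃ M : ℝ, ∀ x, ‖fderiv ℝ f x‖ ≤ M :=
  (hc.fderiv ℝ).exists_bound_of_continuous hf

lemma exists_norm_fderiv_fderiv_le (hΘ : ContDiff ℝ 2 Θ) (hc : HasCompactSupport Θ) :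
    ∃ M : ℝ, ∀ x, ‖fderiv ℝ (fderiv ℝ Θ) x‖ ≤ M :=
  (HasCompactSupport.fderiv ℝ hc).exists_norm_fderiv_le (continuous_fderiv_fderiv hΘ)

/-- The form `(ζ₁, ζ₂) ↦ ∫ D²Θ(x)((ζ₁(xᵢ))ᵢ, (ζ₂(xᵢ))ᵢ) m(dx₁) ⋯ m(dx_k)` is bounded on the tangent
space. -/
lemma exists_polyHess (hΘ : ContDiff ℝ 2 Θ) (hc : HasCompactSupport Θ) (m : P2 d) :
    ∃ H : tangent m →L[ℝ] tangent m →L[ℝ] ℝ, ∀ (z₁ z₂ : tangent m) (ζ₁ ζ₂ : E d → E d),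
      ((z₁ : Lp (E d) 2 m.toMeasure) : E d → E d) =ᵐ[m.toMeasure] ζ₁ →
      ((z₂ : Lp (E d) 2 m.toMeasure) : E d → E d) =ᵐ[m.toMeasure] ζ₂ →
      H z₁ z₂ = polyInt (fun x => fderiv ℝ (fderiv ℝ Θ) x (fun i => ζ₁ (x i))
        fun i => ζ₂ (x i)) m := by
  obtain ⟨M, hM⟩ := exists_norm_fderiv_fderiv_le hΘ hc
  have hA : AEStronglyMeasurable (fderiv ℝ (fderiv ℝ Θ))
      (Measure.pi fun _ : Fin k => m.toMeasure) :=
    (continuous_fderiv_fderiv hΘ).aestronglyMeasurable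
  let J := (diagLift k m).comp (tangent m).subtypeL
  refine ⟨(integralBilin hA hM).bilinearComp J J, fun z₁ z₂ ζ₁ ζ₂ h₁ h₂ => ?_⟩
  rw [ContinuousLinearMap.bilinearComp_apply, integralBilin_apply, polyInt]
  refine integral_congr_ae ?_
  filter_upwards [coeFn_diagLift m h₁, coeFn_diagLift m h₂] with x hx1 hx2
  simp only [J, ContinuousLinearMap.comp_apply, Submodule.subtypeL_apply]
  rw [hx1, hx2]

/-- The Hessian of `polyInt Θ` at `m`. -/
def polyHess (hΘ : ContDiff ℝ 2 Θ) (hc : HasCompactSupport Θ) (m : P2 d) :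
    tangent m →L[ℝ] tangent m →L[ℝ] ℝ :=
  (exists_polyHess hΘ hc m).choose

lemma polyHess_apply (hΘ : ContDiff ℝ 2 Θ) (hc : HasCompactSupport Θ) (m : P2 d)
    {z₁ z₂ : tangent m} {ζ₁ ζ₂ : E d → E d}
    (h₁ : ((z₁ : Lp (E d) 2 m.toMeasure) : E d → E d) =ᵐ[m.toMeasure] ζ₁)
    (h₂ : ((z₂ : Lp (E d) 2 m.toMeasure) : E d → E d) =ᵐ[m.toMeasure] ζ₂) :
    polyHess hΘ hc m z₁ z₂ = polyInt (fun x => fderiv ℝ (fderiv ℝ Θ) x (fun i => ζ₁ (x i))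
      fun i => ζ₂ (x i)) m :=
  (exists_polyHess hΘ hc m).choose_spec z₁ z₂ ζ₁ ζ₂ h₁ h₂

lemma contDiff_gradient {φ : E d → ℝ} (hφ : ContDiff ℝ ∞ φ) : ContDiff ℝ ∞ (gradient φ) :=
  (InnerProductSpace.toDual ℝ (E d)).symm.contDiff.comp (hφ.fderiv_right (by simp))

lemma integrable_of_continuous_hasCompactSupport {F : Type*} [NormedAddCommGroup F]
    {ζ : E d → F} (hζ : Continuous ζ) (hc : HasCompactSupport ζ) (m : P2 d) :
    Integrable ζ m.toMeasure := by
  obtain ⟨M, hM⟩ := hc.exists_bound_of_continuous hζ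
  exact Integrable.of_bound hζ.aestronglyMeasurable M (Eventually.of_forall hM)

lemma dirDeriv_polyInt_eq (hΘ : ContDiff ℝ 2 Θ) (hc : HasCompactSupport Θ) {ζ : E d → E d}
    (hζ : Continuous ζ) (hζc : HasCompactSupport ζ) :
    (fun ν => dirDeriv ζ (polyInt Θ) ν) = polyInt fun x => fderiv ℝ Θ x fun i => ζ (x i) :=
  funext fun ν => dirDeriv_polyInt hΘ hc ν (integrable_of_continuous_hasCompactSupport hζ hζc ν)

/-- Differentiating along a smooth field stays among the functionals `polyInt` at the price of one
order of regularity. The first derivative must still have a `C²` integrand for its own quadratic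
expansion, whence `C³`. -/
theorem isHessAt_polyInt (hΘ : ContDiff ℝ 3 Θ) (hc : HasCompactSupport Θ) (m : P2 d) :
    IsHessAt (polyInt Θ) m (polyHess (hΘ.of_le (by norm_num)) hc m) := by
  have hΘ2 : ContDiff ℝ 2 Θ := hΘ.of_le (by norm_num)
  refine ⟨⟨1, one_pos, fun ν _ => (hasQuadExpansionAt_polyInt hΘ2 hc ν).diffAt⟩,
    fun ζ hζ hζc => ?_, ?_⟩
  · rw [dirDeriv_polyInt_eq hΘ2 hc hζ.continuous hζc]
    exact (hasQuadExpansionAt_polyInt (contDiff_fderiv_apply_comp (n := 2) (by exact_mod_cast hΘ) hζ)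
      (hasCompactSupport_fderiv_apply hc _) m).diffAt
  · intro φ₁ φ₂ hφ₁ hc₁ hφ₂ hc₂ z₁ z₂ hz₁ hz₂
    have hg₁ := contDiff_gradient hφ₁
    have hg₂ := contDiff_gradient hφ₂
    have hgc₁ := hasCompactSupport_gradient hc₁
    have hgc₂ := hasCompactSupport_gradient hc₂
    have hW : Continuous fun x => fderiv ℝ (gradient φ₂) x (gradient φ₁ x) :=
      (hg₂.continuous_fderiv (by simp)).clm_apply hg₁.continuous
    have hWc : HasCompactSupport fun x => fderiv ℝ (gradient φ₂) x (gradient φ₁ x) := by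
      refine hgc₁.mono fun x hx h => ?_
      simp [h] at hx
    have hΘ₂ : ContDiff ℝ 2 fun x => fderiv ℝ Θ x fun i => gradient φ₂ (x i) :=
      contDiff_fderiv_apply_comp (n := 2) (by exact_mod_cast hΘ) hg₂
    have hΘ₂c := hasCompactSupport_fderiv_apply hc fun x i => gradient φ₂ (x i)
    have hc1 : Continuous fun x => fderiv ℝ (fun x => fderiv ℝ Θ x fun i => gradient φ₂ (x i)) x
        fun i => gradient φ₁ (x i) :=
      (hΘ₂.continuous_fderiv (by norm_num)).clm_apply
        (continuous_pi fun i => hg₁.continuous.comp (continuous_apply i))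
    have hc2 : Continuous fun x : Fin k → E d => fderiv ℝ Θ x fun i =>
        fderiv ℝ (gradient φ₂) (x i) (gradient φ₁ (x i)) :=
      (hΘ2.continuous_fderiv (by norm_num)).clm_apply
        (continuous_pi fun i => hW.comp (continuous_apply i))
    rw [polyHess_apply hΘ2 hc m hz₁ hz₂, dirDeriv_polyInt_eq hΘ2 hc hg₂.continuous hgc₂,
      dirDeriv_polyInt hΘ₂ hΘ₂c m (integrable_of_continuous_hasCompactSupport hg₁.continuous hgc₁ m),
      dirDeriv_polyInt hΘ2 hc m (integrable_of_continuous_hasCompactSupport hW hWc m),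
      polyInt, polyInt, polyInt, ← integral_sub
        (integrable_pi_of_continuous_hasCompactSupport hc1 (hasCompactSupport_fderiv_apply hΘ₂c _) m)
        (integrable_pi_of_continuous_hasCompactSupport hc2 (hasCompactSupport_fderiv_apply hc _) m)]
    refine integral_congr_ae (Eventually.of_forall fun x => ?_)
    simp only
    rw [fderiv_fderiv_apply_comp hΘ2 (hg₂.differentiable (by simp)), add_sub_cancel_right]

/-! ### Uniqueness of the Hessian. -/

/-- A bounded linear form on the tangent space that vanishes on gradients of test functions is
zero. -/
lemma eq_zero_of_forall_gradient {m : P2 d} {F : Type*} [NormedAddCommGroup F]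
    [NormedSpace ℝ F] (f : tangent m →L[ℝ] F)
    (h : ∀ φ : E d → ℝ, ContDiff ℝ ∞ φ → HasCompactSupport φ → ∀ z : tangent m,
      ((z : Lp (E d) 2 m.toMeasure) : E d → E d) =ᵐ[m.toMeasure] gradient φ → f z = 0) :
    f = 0 := by
  have : CompleteSpace (tangent m) :=
    (Submodule.isClosed_topologicalClosure _).completeSpace_coe
  have hself : ∀ z : tangent m, (tangent m).orthogonalProjectionOnto (z : Lp (E d) 2 m.toMeasure) = z :=
    fun z => Submodule.orthogonalProjectionOnto_mem_subspace_eq_self z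
  -- Composition with the orthogonal projection turns `f` into a map on all of `L²(m)`, where
  -- density of the span in its closure can be used.
  have hzero : Set.EqOn (f.comp (tangent m).orthogonalProjectionOnto)
      (0 : Lp (E d) 2 m.toMeasure →L[ℝ] F)
      (closure (Submodule.span ℝ {ζ : Lp (E d) 2 m.toMeasure | ∃ φ : E d → ℝ,
      ContDiff ℝ ∞ φ ∧ HasCompactSupport φ ∧
        (ζ : E d → E d) =ᵐ[m.toMeasure] gradient φ} : Set (Lp (E d) 2 m.toMeasure))) := by
    refine ContinuousLinearMap.eqOn_closure_span fun z hz => ?_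
    have hzt : z ∈ tangent m := Submodule.le_topologicalClosure _ (Submodule.subset_span hz)
    obtain ⟨φ, hφ, hc, hzφ⟩ := hz
    have := h φ hφ hc ⟨z, hzt⟩ hzφ
    rw [ContinuousLinearMap.comp_apply, hself ⟨z, hzt⟩, this]
    rfl
  ext z
  have := hzero z.2
  rw [ContinuousLinearMap.comp_apply, hself z] at this
  exact this

/-- The Hessian is unique. -/
lemma IsHessAt.unique {U : P2 d → ℝ} {m : P2 d} {H H' : tangent m →L[ℝ] tangent m →L[ℝ] ℝ}
    (h : IsHessAt U m H) (h' : IsHessAt U m H') : H = H' := by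
  rw [← sub_eq_zero]
  refine eq_zero_of_forall_gradient (m := m) (F := tangent m →L[ℝ] ℝ) (H - H') fun φ₁ hφ₁ hc₁ z₁ hz₁ => ?_
  refine eq_zero_of_forall_gradient (m := m) (F := ℝ) ((H - H') z₁) fun φ₂ hφ₂ hc₂ z₂ hz₂ => ?_
  rw [sub_apply, sub_apply, h.2.2 φ₁ φ₂ hφ₁ hc₁ hφ₂ hc₂ z₁ z₂ hz₁ hz₂,
    h'.2.2 φ₁ φ₂ hφ₁ hc₁ hφ₂ hc₂ z₁ z₂ hz₁ hz₂, sub_self]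

/-! ### The Laplacian and `D₂` of polynomial functionals. -/

/-- The diagonal translation vector `(e_i, …, e_i)` of `(ℝ^d)^k`. -/
def diagVec (d k : ℕ) (i : Fin d) : Fin k → E d := fun _ => EuclideanSpace.single i 1

/-- Both the Hessian and the gradients of the moments are unique, the latter being the constant
fields `e_i`, whose lifts are the vectors `diagVec`. The equivalence yields existence and uniqueness
at once, so the choice made in `wLaplacian` is harmless. -/
theorem hasLaplacianAt_polyInt_iff (hΘ : ContDiff ℝ 3 Θ) (hc : HasCompactSupport Θ) (m : P2 d)
    (L : ℝ) : HasLaplacianAt (polyInt Θ) m L ↔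
      L = ∑ i, polyInt (fun x => fderiv ℝ (fderiv ℝ Θ) x (diagVec d k i) (diagVec d k i)) m := by
  have hΘ2 : ContDiff ℝ 2 Θ := hΘ.of_le (by norm_num)
  have hval : ∀ i, polyHess hΘ2 hc m (coordTangent m i) (coordTangent m i) =
      polyInt (fun x => fderiv ℝ (fderiv ℝ Θ) x (diagVec d k i) (diagVec d k i)) m := fun i =>
    polyHess_apply hΘ2 hc m (coeFn_coordTangent m i) (coeFn_coordTangent m i)
  constructor
  · rintro ⟨H, hH, ζ, hζ, rfl⟩
    have hHeq := hH.unique (isHessAt_polyInt hΘ hc m)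
    have hζeq : ∀ i, ζ i = coordTangent m i := fun i => Subtype.ext
      (((hasQuadExpansionAt_moment i m).isGradAt_iff (coordTangent m i).2 _).1 (hζ i))
    simp only [hHeq, hζeq, hval]
  · rintro rfl
    refine ⟨polyHess hΘ2 hc m, isHessAt_polyInt hΘ hc m, coordTangent m, fun i =>
      ((hasQuadExpansionAt_moment i m).isGradAt_iff (coordTangent m i).2 _).2 rfl, ?_⟩
    simp only [hval]

lemma wLaplacian_polyInt (hΘ : ContDiff ℝ 3 Θ) (hc : HasCompactSupport Θ) (m : P2 d) :
    wLaplacian (polyInt Θ) m =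
      ∑ i, polyInt (fun x => fderiv ℝ (fderiv ℝ Θ) x (diagVec d k i) (diagVec d k i)) m := by
  have hex : ∃ L, HasLaplacianAt (polyInt Θ) m L :=
    ⟨_, (hasLaplacianAt_polyInt_iff hΘ hc m _).2 rfl⟩
  rw [wLaplacian, dif_pos hex]
  exact (hasLaplacianAt_polyInt_iff hΘ hc m _).1 hex.choose_spec

/-- A coordinate of the mean of the gradient is its pairing with a constant field. `D₂` sees only
these means, since `m₁ ⊗ m₂` is a product measure and the inner product is bilinear. -/
lemma integral_wGrad_polyInt (hΘ : ContDiff ℝ 2 Θ) (hc : HasCompactSupport Θ) (m : P2 d)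
    (i : Fin d) : (∫ q, wGrad (polyInt Θ) m q ∂m.toMeasure) i =
      polyInt (fun x => fderiv ℝ Θ x (diagVec d k i)) m := by
  have h := dirDeriv_polyInt hΘ hc m (ζ := fun _ => EuclideanSpace.single i 1)
    (integrable_const _)
  rw [dirDeriv] at h
  have hi : Integrable (wGrad (polyInt Θ) m) m.toMeasure := (Lp.memLp _).integrable one_le_two
  refine Eq.trans ?_ h
  refine ((EuclideanSpace.proj (𝕜 := ℝ) i).integral_comp_comm hi).symm.trans ?_
  refine integral_congr_ae (Eventually.of_forall fun x => ?_)
  simp [EuclideanSpace.inner_single_right]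

/-- `D₂` of two polynomial functionals is a sum of products. -/
lemma D2_polyInt {Ξ : (Fin k → E d) → ℝ} (hΘ : ContDiff ℝ 2 Θ) (hc : HasCompactSupport Θ)
    (hΞ : ContDiff ℝ 2 Ξ) (hΞc : HasCompactSupport Ξ) (z : P2 d × P2 d) :
    D2 (polyInt Θ) (polyInt Ξ) z = ∑ i, polyInt (fun x => fderiv ℝ Θ x (diagVec d k i)) z.1 *
      polyInt (fun x => fderiv ℝ Ξ x (diagVec d k i)) z.2 := by
  have hi₁ : Integrable (wGrad (polyInt Θ) z.1) z.1.toMeasure :=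
    (Lp.memLp _).integrable one_le_two
  have hi₂ : Integrable (wGrad (polyInt Ξ) z.2) z.2.toMeasure :=
    (Lp.memLp _).integrable one_le_two
  have h : ∫ q, inner ℝ (wGrad (polyInt Θ) z.1 q.1) (wGrad (polyInt Ξ) z.2 q.2)
      ∂(z.1.toMeasure.prod z.2.toMeasure) = inner ℝ (∫ q, wGrad (polyInt Θ) z.1 q ∂z.1.toMeasure)
        (∫ q, wGrad (polyInt Ξ) z.2 q ∂z.2.toMeasure) :=
    integral_prod_bilin (innerSL ℝ) hi₁ hi₂
  rw [D2, h, PiLp.inner_apply]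
  refine Finset.sum_congr rfl fun i _ => ?_
  rw [integral_wGrad_polyInt hΘ hc, integral_wGrad_polyInt hΞ hΞc]
  simp [mul_comm]

end Wasserstein

namespace Wasserstein

/-! ### Continuity of polynomial functionals -/

variable {d k : ℕ} {Θ Ξ : (Fin k → E d) → ℝ}

/-- Coupling by `k` independent copies of an optimal plan. The resulting `W₂`-continuity provides
Borel measurability on `𝒫₂`, needed for integration against `ℙ^{I,J,R}`. -/
lemma abs_polyInt_sub_le {K : ℝ≥0} (hK : LipschitzWith K Θ)
    (hb : ∃ M, ∀ x, ‖Θ x‖ ≤ M) (m ν : P2 d) {s : ℝ} (hs : 0 < s) (hW : W2 m ν < s) :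
    |polyInt Θ ν - polyInt Θ m| ≤ K * k * s := by
  obtain ⟨γ, hγ⟩ := optPlans_nonempty m ν
  obtain ⟨M, hM⟩ := hb
  have := isProbabilityMeasure_of_mem_plans hγ.1
  have hcont := hK.continuous
  have hpf : MeasurePreserving (fun p : Fin k → E d × E d => fun i => (p i).1)
      (Measure.pi fun _ => γ) (Measure.pi fun _ => m.toMeasure) :=
    measurePreserving_pi (fun _ => γ) (fun _ => m.toMeasure)
      fun _ => measurePreserving_fst_of_mem_plans hγ.1
  have hps : MeasurePreserving (fun p : Fin k → E d × E d => fun i => (p i).2)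
      (Measure.pi fun _ => γ) (Measure.pi fun _ => ν.toMeasure) :=
    measurePreserving_pi (fun _ => γ) (fun _ => ν.toMeasure)
      fun _ => measurePreserving_snd_of_mem_plans hγ.1
  have hU1 : polyInt Θ m = ∫ p, Θ (fun i => (p i).1) ∂(Measure.pi fun _ : Fin k => γ) :=
    (hpf.integral_comp_of_aestronglyMeasurable hcont.aestronglyMeasurable).symm
  have hU2 : polyInt Θ ν = ∫ p, Θ (fun i => (p i).2) ∂(Measure.pi fun _ : Fin k => γ) :=
    (hps.integral_comp_of_aestronglyMeasurable hcont.aestronglyMeasurable).symm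
  have hi1 : Integrable (fun p : Fin k → E d × E d => Θ fun i => (p i).1)
      (Measure.pi fun _ => γ) := Integrable.of_bound
        (hcont.measurable.comp hpf.measurable).aestronglyMeasurable M
        (Eventually.of_forall fun p => hM _)
  have hi2 : Integrable (fun p : Fin k → E d × E d => Θ fun i => (p i).2)
      (Measure.pi fun _ => γ) := Integrable.of_bound
        (hcont.measurable.comp hps.measurable).aestronglyMeasurable M
        (Eventually.of_forall fun p => hM _)
  have hsub := memLp_sub_of_mem_plans hγ.1
  have hn : Integrable (fun p : E d × E d => ‖p.2 - p.1‖) γ := (hsub.integrable one_le_two).norm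
  have hsq : Integrable (fun p : E d × E d => ‖p.2 - p.1‖ ^ 2) γ :=
    hsub.integrable_norm_pow (by simp)
  have hi4 : ∀ j, Integrable (fun p : Fin k → E d × E d => ‖(p j).2 - (p j).1‖)
      (Measure.pi fun _ => γ) := fun j =>
    (measurePreserving_eval (fun _ : Fin k => γ) j).integrable_comp_of_integrable hn
  -- `a ≤ s/2 + a²/(2s)` replaces the Cauchy–Schwarz inequality; the second term has mean at most
  -- `s/2`.
  have hone : ∫ p, ‖p.2 - p.1‖ ∂γ ≤ s := by
    have h1 : ∫ p, ‖p.2 - p.1‖ ∂γ ≤ ∫ p, (s / 2 + (2 * s)⁻¹ * ‖p.2 - p.1‖ ^ 2) ∂γ := by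
      refine integral_mono hn ((integrable_const _).add (hsq.const_mul _)) fun p => ?_
      simp only
      generalize ‖p.2 - p.1‖ = a
      have h2 : s / 2 + (2 * s)⁻¹ * a ^ 2 - a = (s - a) ^ 2 / (2 * s) := by field_simp; ring
      have h3 : 0 ≤ (s - a) ^ 2 / (2 * s) := by positivity
      linarith
    rw [integral_add (integrable_const _) (hsq.const_mul _), integral_const_mul,
      ← W2_sq_of_mem_optPlans hγ] at h1
    have h4 : W2 m ν ^ 2 ≤ s ^ 2 := by
      have := W2_nonneg m ν
      gcongr
    have h5 : (2 * s)⁻¹ * W2 m ν ^ 2 ≤ (2 * s)⁻¹ * s ^ 2 := by gcongr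
    have h6 : (2 * s)⁻¹ * s ^ 2 = s / 2 := by field_simp
    simp only [integral_const, probReal_univ, one_smul] at h1
    linarith
  rw [hU1, hU2, ← integral_sub hi2 hi1]
  refine abs_integral_le_integral_abs.trans ?_
  have hbound : ∀ p : Fin k → E d × E d,
      |Θ (fun i => (p i).2) - Θ (fun i => (p i).1)| ≤ K * ∑ j, ‖(p j).2 - (p j).1‖ := by
    intro p
    refine (hK.norm_sub_le _ _).trans ?_
    gcongr
    refine (pi_norm_le_iff_of_nonneg (Finset.sum_nonneg fun _ _ => norm_nonneg _)).2 fun j => ?_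
    exact Finset.single_le_sum (f := fun j => ‖(p j).2 - (p j).1‖)
      (fun i _ => norm_nonneg _) (Finset.mem_univ j)
  refine (integral_mono (hi2.sub hi1).abs
    ((integrable_finsetSum _ fun j _ => hi4 j).const_mul K) hbound).trans ?_
  rw [integral_const_mul, integral_finsetSum _ fun j _ => hi4 j, mul_assoc]
  have : ∀ j : Fin k, ∫ p, ‖(p j).2 - (p j).1‖ ∂(Measure.pi fun _ : Fin k => γ) =
      ∫ p, ‖p.2 - p.1‖ ∂γ := fun j =>
    (measurePreserving_eval (fun _ : Fin k => γ) j).integral_comp_of_aestronglyMeasurable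
      (f := fun p : E d × E d => ‖p.2 - p.1‖) hn.aestronglyMeasurable
  simp only [this, Finset.sum_const, Finset.card_univ, Fintype.card_fin, nsmul_eq_mul]
  gcongr

lemma continuous_polyInt (hΘ : ContDiff ℝ 1 Θ) (hc : HasCompactSupport Θ) :
    Continuous (polyInt Θ) := by
  obtain ⟨K, hK⟩ := ContDiff.lipschitzWith_of_hasCompactSupport (𝕂 := ℝ) hc hΘ (by norm_num)
  have hb := hc.exists_bound_of_continuous hΘ.continuous
  refine continuous_def.2 fun s hs m hm => ?_
  obtain ⟨r, hr, hball⟩ := Metric.isOpen_iff.1 hs _ hm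
  refine ⟨r / (K * k + 1), by positivity, fun ν hν => hball ?_⟩
  rw [Metric.mem_ball, Real.dist_eq]
  refine (abs_polyInt_sub_le hK hb m ν (by positivity) hν).trans_lt ?_
  rw [← mul_div_assoc, div_lt_iff₀ (by positivity)]
  nlinarith

lemma norm_polyInt_le {M : ℝ} (hM : ∀ x, ‖Θ x‖ ≤ M) (m : P2 d) : ‖polyInt Θ m‖ ≤ M := by
  refine (norm_integral_le_of_norm_le_const (Eventually.of_forall hM)).trans_eq ?_
  simp

lemma integrable_polyInt_mul_polyInt (hΘ : ContDiff ℝ 1 Θ) (hc : HasCompactSupport Θ)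
    (hΞ : ContDiff ℝ 1 Ξ) (hΞc : HasCompactSupport Ξ) (μ : Measure (P2 d × P2 d))
    [IsFiniteMeasure μ] : Integrable (fun z => polyInt Θ z.1 * polyInt Ξ z.2) μ := by
  obtain ⟨M, hM⟩ := hc.exists_bound_of_continuous hΘ.continuous
  obtain ⟨M', hM'⟩ := hΞc.exists_bound_of_continuous hΞ.continuous
  have h1 : Measurable fun z : P2 d × P2 d => polyInt Θ z.1 :=
    (continuous_polyInt hΘ hc).measurable.comp measurable_fst
  have h2 : Measurable fun z : P2 d × P2 d => polyInt Ξ z.2 :=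
    (continuous_polyInt hΞ hΞc).measurable.comp measurable_snd
  refine Integrable.of_bound (h1.mul h2).aestronglyMeasurable (M * M')
    (Eventually.of_forall fun z => ?_)
  rw [norm_mul]
  have h3 := norm_polyInt_le hM z.1
  exact mul_le_mul h3 (norm_polyInt_le hM' z.2) (norm_nonneg _) ((norm_nonneg _).trans h3)

/-! ### Integration against the signed measure -/

lemma integrable_PkR {R : ℝ} {f : P2 d × P2 d → ℝ}
    (hf : ∀ I J : Finset (Fin k), Integrable f (PIJ d I J R)) : (PkR d k R).Integrable f := by
  refine VectorMeasure.Integrable.smul_vectorMeasure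
    (VectorMeasure.Integrable.finsetSum_vectorMeasure fun r _ =>
      VectorMeasure.Integrable.finsetSum_vectorMeasure fun p _ =>
        VectorMeasure.Integrable.smul_vectorMeasure
          (VectorMeasure.Integrable.finsetSum_vectorMeasure fun I _ =>
            VectorMeasure.Integrable.finsetSum_vectorMeasure fun J _ => ?_) _) _
  rw [VectorMeasure.Integrable, Measure.variation_toSignedMeasure]
  exact hf I J

lemma integral_PkR {R : ℝ} {f : P2 d × P2 d → ℝ}
    (hf : ∀ I J : Finset (Fin k), Integrable f (PIJ d I J R)) :
    ∫ᵛ z, f z ∂<•(PkR d k R) = ((k : ℝ) ^ 2 / (k.factorial : ℝ) ^ 3) *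
      ∑ r ∈ Finset.Icc 1 k, ∑ p ∈ Finset.Icc 1 k,
        ((-1 : ℝ) ^ (r + p) * (r : ℝ) ^ k * (p : ℝ) ^ k) *
          ∑ I ∈ Finset.powersetCard r (Finset.univ : Finset (Fin k)),
            ∑ J ∈ Finset.powersetCard p (Finset.univ : Finset (Fin k)), ∫ z, f z ∂(PIJ d I J R) := by
  have h1 : ∀ I J : Finset (Fin k), (PIJ d I J R).toSignedMeasure.Integrable f := by
    intro I J
    rw [VectorMeasure.Integrable, Measure.variation_toSignedMeasure]
    exact hf I J
  have h2 : ∀ (I : Finset (Fin k)) (p : ℕ),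
      (∑ J ∈ Finset.powersetCard p (Finset.univ : Finset (Fin k)),
        (PIJ d I J R).toSignedMeasure).Integrable f := fun I p =>
    VectorMeasure.Integrable.finsetSum_vectorMeasure fun J _ => h1 I J
  have h3 : ∀ r p : ℕ, (((-1 : ℝ) ^ (r + p) * (r : ℝ) ^ k * (p : ℝ) ^ k) •
      ∑ I ∈ Finset.powersetCard r (Finset.univ : Finset (Fin k)),
        ∑ J ∈ Finset.powersetCard p (Finset.univ : Finset (Fin k)),
          (PIJ d I J R).toSignedMeasure).Integrable f := fun r p =>
    VectorMeasure.Integrable.smul_vectorMeasure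
      (VectorMeasure.Integrable.finsetSum_vectorMeasure fun I _ => h2 I p) _
  rw [PkR, VectorMeasure.integral_smul_vectorMeasure,
    VectorMeasure.integral_finsetSum_vectorMeasure fun r _ =>
      VectorMeasure.Integrable.finsetSum_vectorMeasure fun p _ => h3 r p, smul_eq_mul]
  congr 1
  refine Finset.sum_congr rfl fun r _ => ?_
  rw [VectorMeasure.integral_finsetSum_vectorMeasure fun p _ => h3 r p]
  refine Finset.sum_congr rfl fun p _ => ?_
  rw [VectorMeasure.integral_smul_vectorMeasure,
    VectorMeasure.integral_finsetSum_vectorMeasure fun I _ => h2 I p, smul_eq_mul]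
  congr 1
  refine Finset.sum_congr rfl fun I _ => ?_
  rw [VectorMeasure.integral_finsetSum_vectorMeasure fun J _ => h1 I J]
  exact Finset.sum_congr rfl fun J _ => VectorMeasure.integral_toSignedMeasure

/-! ### Polarization -/

lemma dirac_univ_pi {ι X : Type*} [Fintype ι] [MeasurableSpace X] (y : ι → X) {s : ι → Set X}
    (hs : ∀ i, MeasurableSet (s i)) :
    Measure.dirac y (Set.univ.pi s) = ∏ i, Measure.dirac (y i) (s i) := by
  classical
  rw [Measure.dirac_apply' _ (MeasurableSet.univ_pi hs)]
  simp only [Measure.dirac_apply' _ (hs _), Set.indicator_apply, Set.mem_univ_pi, Pi.one_apply]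
  rw [Finset.prod_ite_zero]
  simp

lemma toMeasure_empirical {I : Finset (Fin k)} (hI : I.Nonempty) (x : Fin k → E d) :
    (empirical I x).toMeasure = (I.card : ℝ≥0∞)⁻¹ • ∑ i ∈ I, Measure.dirac (x i) := by
  simp [empirical, hI]

/-- Drawing `k` independent uniform indices in `I` amounts to drawing a uniform map `τ` from `Fin k`
to `I`. -/
lemma pi_empirical {I : Finset (Fin k)} (hI : I.Nonempty) (x : Fin k → E d) :
    Measure.pi (fun _ : Fin k => (empirical I x).toMeasure) =
      ((I.card : ℝ≥0∞)⁻¹) ^ k • ∑ τ ∈ Fintype.piFinset (fun _ : Fin k => I),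
        Measure.dirac (x ∘ τ) := by
  refine Measure.pi_eq fun s hs => ?_
  simp only [toMeasure_empirical hI, Measure.smul_apply, smul_eq_mul, Measure.finsetSum_apply]
  rw [Finset.prod_mul_distrib, Finset.prod_univ_sum, Finset.prod_const, Finset.card_univ,
    Fintype.card_fin]
  congr 1
  exact Finset.sum_congr rfl fun τ _ => dirac_univ_pi _ hs

/-- The weight `r^k` in `ℙ^{k,R}` clears the normalization, after which `I` enters only through the
condition that `τ` takes its values in `I`. The empty set is allowed: both sides are `0` because `k
≥ 1`. -/
lemma card_pow_mul_polyInt_empirical (hk : 1 ≤ k) (hΘ : Continuous Θ) (I : Finset (Fin k))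
    (x : Fin k → E d) : (I.card : ℝ) ^ k * polyInt Θ (empirical I x) =
      ∑ τ ∈ Fintype.piFinset (fun _ : Fin k => I), Θ (x ∘ τ) := by
  have hk0 : k ≠ 0 := by omega
  rcases I.eq_empty_or_nonempty with rfl | hI
  · have : Nonempty (Fin k) := ⟨⟨0, hk⟩⟩
    rw [Fintype.piFinset_empty]
    simp [hk0]
  · rw [polyInt, pi_empirical hI, integral_smul_measure, integral_finsetSum_measure]
    · have h0 : (I.card : ℝ) ≠ 0 := by simpa using hI.ne_empty
      simp only [integral_dirac' _ _ hΘ.stronglyMeasurable]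
      simp [h0]
    · intro τ _
      exact integrable_dirac' hΘ.stronglyMeasurable (by simp)

/-- Passing to complements gives an alternating sum over all subsets of `Sᶜ`, which vanishes unless
`Sᶜ` is empty. -/
lemma sum_neg_one_pow_card_filter_subset (S : Finset (Fin k)) :
    ∑ I : Finset (Fin k) with S ⊆ I, (-1 : ℝ) ^ I.card =
      if S = Finset.univ then (-1) ^ k else 0 := by
  have h1 : ∑ I : Finset (Fin k) with S ⊆ I, (-1 : ℝ) ^ I.card =
      ∑ T ∈ Sᶜ.powerset, (-1 : ℝ) ^ k * (-1) ^ T.card := by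
    refine Finset.sum_nbij' (fun I => Iᶜ) (fun T => Tᶜ) ?_ ?_ ?_ ?_ ?_
    · intro I hI
      simpa only [Finset.mem_powerset, Finset.compl_subset_compl, Finset.mem_filter,
        Finset.mem_univ, true_and] using hI
    · intro T hT
      simpa only [Finset.mem_filter, Finset.mem_univ, true_and, Finset.mem_powerset,
        Finset.subset_compl_comm] using hT
    · simp
    · simp
    · intro I _
      have h2 : I.card + Iᶜ.card = k := by simp
      rw [← pow_add]
      have : k + Iᶜ.card = I.card + 2 * Iᶜ.card := by omega
      rw [this, pow_add, pow_mul]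
      simp
  have h3 := Finset.sum_powerset_neg_one_pow_card (x := Sᶜ)
  have h4 : ∑ T ∈ Sᶜ.powerset, (-1 : ℝ) ^ T.card = if Sᶜ = ∅ then 1 else 0 := by
    exact_mod_cast h3
  rw [h1, ← Finset.mul_sum, h4]
  simp [Finset.compl_eq_empty_iff]

/-- Polarization: a symmetric function is recovered from the values of its polynomial functional at
empirical measures. -/
theorem sum_polyInt_empirical (hk : 1 ≤ k) (hΘ : Continuous Θ)
    (hsymm : ∀ (σ : Equiv.Perm (Fin k)) (x : Fin k → E d), Θ (x ∘ σ) = Θ x) (x : Fin k → E d) :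
    ∑ r ∈ Finset.Icc 1 k, (-1 : ℝ) ^ r * (r : ℝ) ^ k *
      ∑ I ∈ Finset.powersetCard r (Finset.univ : Finset (Fin k)), polyInt Θ (empirical I x) =
    (-1) ^ k * k.factorial * Θ x := by
  have hk0 : k ≠ 0 := by omega
  have h1 : ∑ r ∈ Finset.Icc 1 k, (-1 : ℝ) ^ r * (r : ℝ) ^ k *
      ∑ I ∈ Finset.powersetCard r (Finset.univ : Finset (Fin k)), polyInt Θ (empirical I x) =
      ∑ I : Finset (Fin k), (-1 : ℝ) ^ I.card * ((I.card : ℝ) ^ k * polyInt Θ (empirical I x)) := by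
    rw [← Finset.powerset_univ, Finset.sum_powerset, Finset.card_univ, Fintype.card_fin]
    -- The index `r = 0` may be added, as its weight `0 ^ k` vanishes.
    rw [Finset.sum_subset (s₁ := Finset.Icc 1 k) (s₂ := Finset.range (k + 1))]
    · refine Finset.sum_congr rfl fun r _ => ?_
      rw [Finset.mul_sum]
      refine Finset.sum_congr rfl fun I hI => ?_
      rw [(Finset.mem_powersetCard.1 hI).2, mul_assoc]
    · intro r hr
      simp only [Finset.mem_Icc, Finset.mem_range] at hr ⊢
      omega
    · intro r hr hr'
      have : r = 0 := by
        simp only [Finset.mem_Icc, Finset.mem_range] at hr hr'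
        omega
      simp [this, hk0]
  rw [h1]
  simp_rw [card_pow_mul_polyInt_empirical hk hΘ]
  have h2 : ∀ I : Finset (Fin k), (-1 : ℝ) ^ I.card *
      ∑ τ ∈ Fintype.piFinset (fun _ : Fin k => I), Θ (x ∘ τ) =
      ∑ τ : Fin k → Fin k, if Finset.univ.image τ ⊆ I then (-1 : ℝ) ^ I.card * Θ (x ∘ τ) else 0 := by
    intro I
    rw [Finset.mul_sum, ← Finset.sum_filter]
    refine Finset.sum_congr ?_ fun _ _ => rfl
    ext τ
    simp [Fintype.mem_piFinset, Finset.image_subset_iff]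
  simp_rw [h2]
  rw [Finset.sum_comm]
  -- Inclusion–exclusion over the sets `I` containing the image of `τ` keeps only surjective maps,
  -- that is permutations, and each contributes `Θ x` by symmetry.
  have h3 : ∀ τ : Fin k → Fin k, (∑ I : Finset (Fin k),
      if Finset.univ.image τ ⊆ I then (-1 : ℝ) ^ I.card * Θ (x ∘ τ) else 0) =
      if Function.Bijective τ then (-1) ^ k * Θ x else 0 := by
    intro τ
    rw [← Finset.sum_filter, ← Finset.sum_mul, sum_neg_one_pow_card_filter_subset]
    have h4 : Finset.univ.image τ = Finset.univ ↔ Function.Bijective τ := by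
      rw [← Finset.coe_eq_univ, Finset.coe_image, Finset.coe_univ, Set.image_univ,
        Set.range_eq_univ, Finite.surjective_iff_bijective]
    by_cases hτ : Function.Bijective τ
    · rw [if_pos (h4.2 hτ), if_pos hτ]
      congr 1
      exact hsymm (Equiv.ofBijective τ hτ) x
    · rw [if_neg (mt h4.1 hτ), if_neg hτ, zero_mul]
  simp_rw [h3]
  rw [← Finset.sum_filter, Finset.sum_const, nsmul_eq_mul]
  have h5 : (Finset.univ.filter fun τ : Fin k → Fin k => Function.Bijective τ).card =
      k.factorial := by
    rw [← Fintype.card_subtype]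
    rw [Fintype.card_congr (Equiv.ofBijective
      (fun σ : Equiv.Perm (Fin k) => (⟨σ, σ.bijective⟩ : {τ : Fin k → Fin k // τ.Bijective}))
      ⟨fun σ σ' h => Equiv.ext fun i => congrFun (congrArg Subtype.val h) i,
        fun τ => ⟨Equiv.ofBijective τ.1 τ.2, rfl⟩⟩).symm, Fintype.card_perm, Fintype.card_fin]
  rw [h5]
  ring

/-- Integration of a product of polynomial functionals against `ℙ^{k,R}`. -/
theorem integral_polyInt_mul_polyInt_PkR (hk : 1 ≤ k) {R : ℝ}
    (hΘ : ContDiff ℝ 1 Θ) (hc : HasCompactSupport Θ)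
    (hΘs : ∀ (σ : Equiv.Perm (Fin k)) (x : Fin k → E d), Θ (x ∘ σ) = Θ x)
    (hΞ : ContDiff ℝ 1 Ξ) (hΞc : HasCompactSupport Ξ)
    (hΞs : ∀ (σ : Equiv.Perm (Fin k)) (x : Fin k → E d), Ξ (x ∘ σ) = Ξ x) :
    ∫ᵛ z, polyInt Θ z.1 * polyInt Ξ z.2 ∂<•(PkR d k R) =
      ((k : ℝ) ^ 2 / k.factorial) * ∫ x in ballPow d k R, Θ x * Ξ x := by
  have hf := fun I J : Finset (Fin k) =>
    integrable_polyInt_mul_polyInt hΘ hc hΞ hΞc (PIJ d I J R)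
  have hmap : ∀ I J : Finset (Fin k), ∫ z, polyInt Θ z.1 * polyInt Ξ z.2 ∂(PIJ d I J R) =
      ∫ x in ballPow d k R, polyInt Θ (empirical I x) * polyInt Ξ (empirical J x) := by
    intro I J
    have := (hf I J).aestronglyMeasurable
    rw [PIJ] at this ⊢
    rw [integral_map (measurable_empirical_pair I J).aemeasurable this]
  have hint : ∀ I J : Finset (Fin k), IntegrableOn
      (fun x => polyInt Θ (empirical I x) * polyInt Ξ (empirical J x)) (ballPow d k R) := by
    intro I J
    have := hf I J
    rw [PIJ, integrable_map_measure (by rw [← PIJ]; exact this.aestronglyMeasurable)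
      (measurable_empirical_pair I J).aemeasurable] at this
    exact this
  rw [integral_PkR hf]
  simp_rw [hmap]
  have hpush : ∑ r ∈ Finset.Icc 1 k, ∑ p ∈ Finset.Icc 1 k,
        ((-1 : ℝ) ^ (r + p) * (r : ℝ) ^ k * (p : ℝ) ^ k) *
          ∑ I ∈ Finset.powersetCard r (Finset.univ : Finset (Fin k)),
            ∑ J ∈ Finset.powersetCard p (Finset.univ : Finset (Fin k)),
              ∫ x in ballPow d k R, polyInt Θ (empirical I x) * polyInt Ξ (empirical J x) =
      ∫ x in ballPow d k R, ∑ r ∈ Finset.Icc 1 k, ∑ p ∈ Finset.Icc 1 k,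
        ((-1 : ℝ) ^ (r + p) * (r : ℝ) ^ k * (p : ℝ) ^ k) *
          ∑ I ∈ Finset.powersetCard r (Finset.univ : Finset (Fin k)),
            ∑ J ∈ Finset.powersetCard p (Finset.univ : Finset (Fin k)),
              polyInt Θ (empirical I x) * polyInt Ξ (empirical J x) := by
    have i1 := fun (I : Finset (Fin k)) (p : ℕ) => integrable_finsetSum
      (Finset.powersetCard p (Finset.univ : Finset (Fin k))) fun J _ => hint I J
    have i2 := fun r p : ℕ => (integrable_finsetSum
      (Finset.powersetCard r (Finset.univ : Finset (Fin k))) fun I _ => i1 I p).const_mul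
      ((-1 : ℝ) ^ (r + p) * (r : ℝ) ^ k * (p : ℝ) ^ k)
    rw [integral_finsetSum _ fun r _ => integrable_finsetSum _ fun p _ => i2 r p]
    refine Finset.sum_congr rfl fun r _ => ?_
    rw [integral_finsetSum _ fun p _ => i2 r p]
    refine Finset.sum_congr rfl fun p _ => ?_
    rw [integral_const_mul, integral_finsetSum _ fun I _ => i1 I p]
    congr 1
    refine Finset.sum_congr rfl fun I _ => ?_
    rw [integral_finsetSum _ fun J _ => hint I J]
  rw [hpush]
  -- The weights factor in `r` and `p`, so this is the product of two polarization identities at the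
  -- same `x`; the two signs `(-1)^k` cancel.
  have hpt : ∀ x : Fin k → E d, ∑ r ∈ Finset.Icc 1 k, ∑ p ∈ Finset.Icc 1 k,
        ((-1 : ℝ) ^ (r + p) * (r : ℝ) ^ k * (p : ℝ) ^ k) *
          ∑ I ∈ Finset.powersetCard r (Finset.univ : Finset (Fin k)),
            ∑ J ∈ Finset.powersetCard p (Finset.univ : Finset (Fin k)),
              polyInt Θ (empirical I x) * polyInt Ξ (empirical J x) =
      (k.factorial : ℝ) ^ 2 * (Θ x * Ξ x) := by
    intro x
    have hT := sum_polyInt_empirical hk hΘ.continuous hΘs x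
    have hX := sum_polyInt_empirical hk hΞ.continuous hΞs x
    have hprod := congrArg₂ (· * ·) hT hX
    simp only [Finset.sum_mul_sum] at hprod
    have hsign : ((-1 : ℝ) ^ k) * (-1) ^ k = 1 := by rw [← mul_pow]; simp
    refine Eq.trans ?_ (hprod.trans ?_)
    · refine Finset.sum_congr rfl fun r _ => Finset.sum_congr rfl fun p _ => ?_
      rw [← Finset.sum_mul_sum, pow_add]
      ring
    · linear_combination ((k.factorial : ℝ) ^ 2 * (Θ x * Ξ x)) * hsign
  simp_rw [hpt]
  rw [integral_const_mul]
  have hfac : (k.factorial : ℝ) ≠ 0 := by positivity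
  field_simp

end Wasserstein

namespace Wasserstein

/-! ### Integration by parts -/

variable {d k : ℕ} {Θ Ξ : (Fin k → E d) → ℝ}

/-- Permuting the variables fixes a diagonal vector, so differentiation along it preserves symmetry
and polarization still applies to the derivatives. -/
lemma fderiv_diagVec_symm (hΘ : Differentiable ℝ Θ)
    (hs : ∀ (σ : Equiv.Perm (Fin k)) (x : Fin k → E d), Θ (x ∘ σ) = Θ x) (i : Fin d)
    (σ : Equiv.Perm (Fin k)) (x : Fin k → E d) :
    fderiv ℝ Θ (x ∘ σ) (diagVec d k i) = fderiv ℝ Θ x (diagVec d k i) := by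
  let P : (Fin k → E d) →L[ℝ] (Fin k → E d) :=
    ContinuousLinearMap.pi fun j => ContinuousLinearMap.proj (R := ℝ) (φ := fun _ => E d) (σ j)
  have h1 : HasFDerivAt (Θ ∘ P) ((fderiv ℝ Θ (P x)).comp P) x :=
    (hΘ (P x)).hasFDerivAt.comp x P.hasFDerivAt
  have h2 : Θ ∘ P = Θ := funext fun y => hs σ y
  rw [h2] at h1
  rw [h1.fderiv]
  rfl

lemma fderiv_fderiv_diagVec (hΘ : ContDiff ℝ 2 Θ) (w x : Fin k → E d) :
    fderiv ℝ (fderiv ℝ Θ) x w w = fderiv ℝ (fun x => fderiv ℝ Θ x w) x w := by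
  have h1 : HasFDerivAt (fderiv ℝ Θ) (fderiv ℝ (fderiv ℝ Θ) x) x :=
    (((hΘ.fderiv_right (m := 1) (by norm_num)).differentiable (by norm_num)) x).hasFDerivAt
  rw [(h1.clm_apply (hasFDerivAt_const w x)).fderiv]
  simp

lemma contDiff_fderiv_apply_const {n : ℕ} (hΘ : ContDiff ℝ (n + 1) Θ) (w : Fin k → E d) :
    ContDiff ℝ n fun x => fderiv ℝ Θ x w :=
  (hΘ.fderiv_right le_rfl).clm_apply contDiff_const

lemma hasCompactSupport_of_tsupport_subset_ballPow {R : ℝ} (h : tsupport Θ ⊆ ballPow d k R) :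
    HasCompactSupport Θ :=
  (isCompact_ballPow d k R).of_isClosed_subset (isClosed_tsupport Θ) h

/-- `Ξ` and its derivative vanish off `B_R^k`, so both integrals extend to the whole space and there
is no boundary term. The support of one factor is enough. -/
lemma integral_ballPow_by_parts {R : ℝ} (hΘ : ContDiff ℝ 1 Θ) (hΞ : ContDiff ℝ 1 Ξ)
    (hΞR : tsupport Ξ ⊆ ballPow d k R) (w : Fin k → E d) :
    ∫ x in ballPow d k R, Θ x * fderiv ℝ Ξ x w =
      -∫ x in ballPow d k R, fderiv ℝ Θ x w * Ξ x := by
  have hΞc := hasCompactSupport_of_tsupport_subset_ballPow hΞR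
  have hdΘ : Continuous fun x => fderiv ℝ Θ x w :=
    (hΘ.continuous_fderiv (by norm_num)).clm_apply continuous_const
  have hdΞ : Continuous fun x => fderiv ℝ Ξ x w :=
    (hΞ.continuous_fderiv (by norm_num)).clm_apply continuous_const
  have hdΞc : HasCompactSupport fun x => fderiv ℝ Ξ x w :=
    hasCompactSupport_fderiv_apply hΞc fun _ => w
  rw [setIntegral_eq_integral_of_forall_compl_eq_zero fun x hx => ?_,
    setIntegral_eq_integral_of_forall_compl_eq_zero fun x hx => ?_]
  · exact integral_mul_fderiv_eq_neg_fderiv_mul_of_integrable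
      ((hdΘ.mul hΞ.continuous).integrable_of_hasCompactSupport hΞc.mul_left)
      ((hΘ.continuous.mul hdΞ).integrable_of_hasCompactSupport hdΞc.mul_left)
      ((hΘ.continuous.mul hΞ.continuous).integrable_of_hasCompactSupport hΞc.mul_left)
      (fun x _ => hΘ.differentiable (by norm_num) x) fun x _ => hΞ.differentiable (by norm_num) x
  · rw [image_eq_zero_of_notMem_tsupport fun h => hx (hΞR h), mul_zero]
  · rw [fderiv_of_notMem_tsupport (𝕜 := ℝ) fun h => hx (hΞR h)]
    simp

/-- The integration by parts formula for polynomial functionals. -/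
theorem integral_wLaplacian_polyInt (hk : 1 ≤ k) {R : ℝ}
    (hΘ : ContDiff ℝ 3 Θ) (hΞ : ContDiff ℝ 3 Ξ)
    (hΘs : ∀ (σ : Equiv.Perm (Fin k)) (x : Fin k → E d), Θ (x ∘ σ) = Θ x)
    (hΞs : ∀ (σ : Equiv.Perm (Fin k)) (x : Fin k → E d), Ξ (x ∘ σ) = Ξ x)
    (hΘR : tsupport Θ ⊆ ballPow d k R) (hΞR : tsupport Ξ ⊆ ballPow d k R) :
    (PkR d k R).Integrable (fun z => wLaplacian (polyInt Θ) z.1 * polyInt Ξ z.2) ∧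
    (PkR d k R).Integrable (D2 (polyInt Θ) (polyInt Ξ)) ∧
    -∫ᵛ z, wLaplacian (polyInt Θ) z.1 * polyInt Ξ z.2 ∂<•(PkR d k R) =
      ∫ᵛ z, D2 (polyInt Θ) (polyInt Ξ) z ∂<•(PkR d k R) := by
  have hc := hasCompactSupport_of_tsupport_subset_ballPow hΘR
  have hΞc := hasCompactSupport_of_tsupport_subset_ballPow hΞR
  have hΘ2 : ContDiff ℝ 2 Θ := hΘ.of_le (by norm_num)
  have hΞ2 : ContDiff ℝ 2 Ξ := hΞ.of_le (by norm_num)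
  have hΞ1 : ContDiff ℝ 1 Ξ := hΞ.of_le (by norm_num)
  let DΘ : Fin d → (Fin k → E d) → ℝ := fun i x => fderiv ℝ Θ x (diagVec d k i)
  let DΞ : Fin d → (Fin k → E d) → ℝ := fun i x => fderiv ℝ Ξ x (diagVec d k i)
  let DDΘ : Fin d → (Fin k → E d) → ℝ := fun i x => fderiv ℝ (DΘ i) x (diagVec d k i)
  have hDΘ2 : ∀ i, ContDiff ℝ 2 (DΘ i) := fun i =>
    contDiff_fderiv_apply_const (n := 2) (by exact_mod_cast hΘ) _
  have hDΘ1 : ∀ i, ContDiff ℝ 1 (DΘ i) := fun i => (hDΘ2 i).of_le (by norm_num)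
  have hDΞ1 : ∀ i, ContDiff ℝ 1 (DΞ i) := fun i =>
    contDiff_fderiv_apply_const (n := 1) (by exact_mod_cast hΞ2) _
  -- The third derivative of `Θ` is used here: the continuity of `polyInt (DDΘ i)` on `𝒫₂` is
  -- obtained from a `C¹` integrand.
  have hDDΘ1 : ∀ i, ContDiff ℝ 1 (DDΘ i) := fun i =>
    contDiff_fderiv_apply_const (n := 1) (by exact_mod_cast hDΘ2 i) _
  have hDΘc : ∀ i, HasCompactSupport (DΘ i) := fun i =>
    hasCompactSupport_fderiv_apply hc fun _ => diagVec d k i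
  have hDΞc : ∀ i, HasCompactSupport (DΞ i) := fun i =>
    hasCompactSupport_fderiv_apply hΞc fun _ => diagVec d k i
  have hDDΘc : ∀ i, HasCompactSupport (DDΘ i) := fun i =>
    hasCompactSupport_fderiv_apply (hDΘc i) fun _ => diagVec d k i
  have hDΘs := fun i => fderiv_diagVec_symm (hΘ.differentiable (by norm_num)) hΘs i
  have hDΞs := fun i => fderiv_diagVec_symm (hΞ.differentiable (by norm_num)) hΞs i
  have hDDΘs := fun i => fderiv_diagVec_symm ((hDΘ1 i).differentiable (by norm_num)) (hDΘs i) i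
  have hlap : (fun z : P2 d × P2 d => wLaplacian (polyInt Θ) z.1 * polyInt Ξ z.2) =
      fun z => ∑ i, polyInt (DDΘ i) z.1 * polyInt Ξ z.2 := by
    funext z
    rw [wLaplacian_polyInt hΘ hc, Finset.sum_mul]
    simp_rw [fderiv_fderiv_diagVec hΘ2]
    rfl
  have hD2 : D2 (polyInt Θ) (polyInt Ξ) =
      fun z => ∑ i, polyInt (DΘ i) z.1 * polyInt (DΞ i) z.2 :=
    funext fun z => D2_polyInt hΘ2 hc hΞ2 hΞc z
  have hI1 : ∀ i ∈ Finset.univ, (PkR d k R).Integrable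
      fun z => polyInt (DDΘ i) z.1 * polyInt Ξ z.2 := fun i _ =>
    integrable_PkR fun I J => integrable_polyInt_mul_polyInt (hDDΘ1 i) (hDDΘc i) hΞ1 hΞc _
  have hI2 : ∀ i ∈ Finset.univ, (PkR d k R).Integrable
      fun z => polyInt (DΘ i) z.1 * polyInt (DΞ i) z.2 := fun i _ =>
    integrable_PkR fun I J =>
      integrable_polyInt_mul_polyInt (hDΘ1 i) (hDΘc i) (hDΞ1 i) (hDΞc i) _
  rw [hlap, hD2]
  refine ⟨VectorMeasure.Integrable.fun_finsetSum _ hI1,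
    VectorMeasure.Integrable.fun_finsetSum _ hI2, ?_⟩
  rw [VectorMeasure.integral_finsetSum _ hI1, VectorMeasure.integral_finsetSum _ hI2,
    ← Finset.sum_neg_distrib]
  refine Finset.sum_congr rfl fun i _ => ?_
  -- Both sides acquire the same factor `k² / k!`, and one integration by parts along `diagVec d k
  -- i` matches the integrals.
  rw [integral_polyInt_mul_polyInt_PkR hk (hDDΘ1 i) (hDDΘc i) (hDDΘs i) hΞ1 hΞc hΞs,
    integral_polyInt_mul_polyInt_PkR hk (hDΘ1 i) (hDΘc i) (hDΘs i) (hDΞ1 i) (hDΞc i) (hDΞs i),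
    integral_ballPow_by_parts (hDΘ1 i) hΞ1 hΞR (diagVec d k i)]
  ring

end Wasserstein

end

/-! ### The theorem for `F_Φ` and `F_Ψ`. -/

open Wasserstein
theorem mainTheorem8 (d k : ℕ) (hk : 1 ≤ k) (R : ℝ) (hR : 0 < R)
    (Φ Ψ : (Fin k → E d) → ℝ)
    (hΦ : ContDiff ℝ 3 Φ) (hΨ : ContDiff ℝ 3 Ψ)
    (hΦsymm : ∀ (σ : Equiv.Perm (Fin k)) (x : Fin k → E d), Φ (x ∘ σ) = Φ x)
    (hΨsymm : ∀ (σ : Equiv.Perm (Fin k)) (x : Fin k → E d), Ψ (x ∘ σ) = Ψ x)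
    (hΦsupp : tsupport Φ ⊆ ballPow d k R) (hΨsupp : tsupport Ψ ⊆ ballPow d k R) :
    (∀ m : P2 d, DiffAt (polyF Φ) m ∧ ∃! ζ, IsGradAt (polyF Φ) m ζ) ∧
    (∀ m : P2 d, DiffAt (polyF Ψ) m ∧ ∃! ζ, IsGradAt (polyF Ψ) m ζ) ∧
    (∀ m : P2 d, ∃! L, HasLaplacianAt (polyF Φ) m L) ∧
    (PkR d k R).Integrable (fun z => wLaplacian (polyF Φ) z.1 * polyF Ψ z.2) ∧
    (PkR d k R).Integrable (D2 (polyF Φ) (polyF Ψ)) ∧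
    -∫ᵛ z, wLaplacian (polyF Φ) z.1 * polyF Ψ z.2 ∂<•(PkR d k R) =
      ∫ᵛ z, D2 (polyF Φ) (polyF Ψ) z ∂<•(PkR d k R) := by
  have hgrad : ∀ {Θ : (Fin k → E d) → ℝ}, ContDiff ℝ 3 Θ → HasCompactSupport Θ →
      ∀ m : P2 d, DiffAt (polyInt Θ) m ∧ ∃! ζ, IsGradAt (polyInt Θ) m ζ := fun hΘ hc m =>
    have h := hasQuadExpansionAt_polyInt (hΘ.of_le (by norm_num)) hc m
    ⟨h.diffAt, h.existsUnique_isGradAt (polyGrad_mem_tangent _ _ _)⟩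
  -- The factor `1/k` goes into the integrand, which keeps its regularity, symmetry and support
  -- condition.
  have hΦ' : ContDiff ℝ 3 fun x => (1 / (k : ℝ)) * Φ x := contDiff_const.mul hΦ
  have hΨ' : ContDiff ℝ 3 fun x => (1 / (k : ℝ)) * Ψ x := contDiff_const.mul hΨ
  have hΦR : tsupport (fun x => (1 / (k : ℝ)) * Φ x) ⊆ ballPow d k R :=
    tsupport_mul_subset_right.trans hΦsupp
  have hΨR : tsupport (fun x => (1 / (k : ℝ)) * Ψ x) ⊆ ballPow d k R :=
    tsupport_mul_subset_right.trans hΨsupp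
  have hΦc := hasCompactSupport_of_tsupport_subset_ballPow hΦR
  have hΨc := hasCompactSupport_of_tsupport_subset_ballPow hΨR
  simp only [polyF_eq_polyInt Φ, polyF_eq_polyInt Ψ]
  refine ⟨hgrad hΦ' hΦc, hgrad hΨ' hΨc, fun m => ?_, ?_⟩
  · exact ⟨_, (hasLaplacianAt_polyInt_iff hΦ' hΦc m _).2 rfl,
      fun L hL => (hasLaplacianAt_polyInt_iff hΦ' hΦc m L).1 hL⟩
  · exact integral_wLaplacian_polyInt hk hΦ' hΨ' (fun σ x => by rw [hΦsymm])
      (fun σ x => by rw [hΨsymm]) hΦR hΨR
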